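/- Let $d\ge 1$, $s>0$ and $\varepsilon>\max\{d/2,\,1+d/4\}$. For $n\in\mathbb N$, $n\ge1$, let $\mathbb Z_n^d$ be the discrete torus of side length $n$, with the inner product $\langle f,g\rangle=n^{-d}\sum_{z}f(z)\overline{g(z)}$ on $\ell^2(\mathbb Z_n^d)$ and the characters $\psi_w(z)=e^{2\pi i z\cdot w/n}$; let $\lambda_w=-\frac{4}{2d}\sum_{i=1}^d\sin^2(\pi w_i/n)$ be the eigenvalues of the graph Laplacian $\Delta_g$, and put $$(-\Delta_g)^{-2s}f=\sum_{\nu\in\mathbb Z_n^d\setminus\{0\}}(-\lambda_\nu)^{-2s}\langle f,\psi_\nu\rangle\,\psi_\nu ,\qquad a_n=\frac{4\pi^2}{2d\,n^{2}} .$$ Let $\sigma_n=(\sigma_n(z))_{z\in\mathbb Z_n^d}$ be jointly Gaussian with law $\mathcal N(0,a_n^{2s}(-\Delta_g)^{-2s})$ on $\ell^2(\mathbb Z_n^d)$, i.e. centered with $\mathbb E[\langle\sigma_n,f\rangle\langle\sigma_n,g\rangle]=a_n^{2s}\langle(-\Delta_g)^{-2s}f,g\rangle$ for all real $f,g$; equivalently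 $\mathbb E[\sigma_n(x)\sigma_n(y)]=\sum_{\nu\neq0}a_n^{2s}(-\lambda_\nu)^{-2s}\psi_\nu(x-y)$. Start the divisible sandpile from $s_n(x)=1+\sigma_n(x)-n^{-d}\sum_z\sigma_n(z)$: at each time step all vertices with mass larger than $1$ simultaneously keep mass $1$ and distribute their excess uniformly among their $2d$ neighbours. Let $u_n(x)$ be the odometer, the total mass emitted from $x$. It is finite. Let $\mathbb T^d=(\mathbb R/\mathbb Z)^d$ and $$\Xi_n(x)=\sum_{z\in n^{-1}\mathbb Z_n^d}u_n(nz)\,1_{B(z,\frac1{2n})}(x),\qquad x\in\mathbb T^d,$$ with $B(z,\rho)$ the ball in the $\ell^\infty$-metric. Let $H_K^{-\varepsilon}(\mathbb T^d)$ be the Hilbert space completion of the real smooth functions with mean zero on $\mathbb T^d$ under the norm $\|f\|^2=\sum_{\xi\in\mathbb Z^d\setminus\{0\}}\|\xi\|^{-4s}\|\xi\|^{-4\varepsilon}|\widehat f(\xi)|^2$, where functions are considered modulo constants. Then, as $n\to\infty$, $a_n\Xi_n$ converges in law in $H_K^{-\varepsilon}(\mathbb T^d)$ to the Gaussian field $\Xi$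 whose law on $H_K^{-\varepsilon}(\mathbb T^d)$ is the unique one such that for every real $f\in C^\infty(\mathbb T^d)$ with mean zero $$\langle\Xi,f\rangle\sim\mathcal N\bigl(0,\|(-\Delta)^{-(s+1)}f\|_{L^2(\mathbb T^d)}^2\bigr),\qquad (-\Delta)^{a}f:=\sum_{\nu\in\mathbb Z^d\setminus\{0\}}\|\nu\|^{2a}\widehat f(\nu)e^{2\pi i\nu\cdot x}.$$ -/

import Mathlib

open MeasureTheory ProbabilityTheory Filter Topology
open scoped ENNReal ComplexConjugate

namespace Sandpile

noncomputable section

/-! ### The discrete torus -/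

/-- The discrete torus `ℤ_n^d` of side length `n`. -/
abbrev DTorus (d n : ℕ) : Type := Fin d → ZMod n

/-- The scaling `a_n = 4 π² (2d)⁻¹ n⁻²`. -/
def scaling (d n : ℕ) : ℝ := 4 * Real.pi ^ 2 * (2 * (d : ℝ))⁻¹ * ((n : ℝ) ^ 2)⁻¹

/-- The inner product `⟨f, g⟩ = n^{-d} ∑_z f(z) conj (g(z))` of `ℓ²(ℤ_n^d)`. -/
def discInner {d n : ℕ} [NeZero n] (f g : DTorus d n → ℂ) : ℂ :=
  ((n : ℂ) ^ d)⁻¹ * ∑ z, f z * conj (g z)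

/-- The character `ψ_w(z) = exp (2πi z·w/n)`; `ZMod.stdAddChar` sends `j mod n` to
`exp (2πi j/n)`. -/
def discChar {d n : ℕ} [NeZero n] (w z : DTorus d n) : ℂ :=
  ZMod.stdAddChar (∑ i, z i * w i)

/-- The eigenvalue `λ_w = -(4/2d) ∑_i sin² (π w_i / n)` of the graph Laplacian
`Δ_g f(x) = (2d)⁻¹ ∑_{y ∼ x} (f(y) - f(x))` belonging to `ψ_w`. -/
def eigenvalue {d n : ℕ} (w : DTorus d n) : ℝ :=
  -(4 / (2 * (d : ℝ))) * ∑ i, Real.sin (Real.pi * ((w i).val : ℝ) / (n : ℝ)) ^ 2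

/-- The discrete fractional Laplacian
`(-Δ_g)^{-t} f = ∑_{ν ≠ 0} (-λ_ν)^{-t} ⟨f, ψ_ν⟩ ψ_ν`. -/
def discFracLaplacian {d n : ℕ} [NeZero n] (t : ℝ) (f : DTorus d n → ℂ) : DTorus d n → ℂ :=
  fun x => ∑ ν ∈ Finset.univ.filter (fun ν : DTorus d n => ν ≠ 0),
    (((-eigenvalue ν) ^ (-t) : ℝ) : ℂ) * discInner f (discChar ν) * discChar ν x

/-- `σ` has the law `𝒩(0, A)` on `ℓ²(ℤ_n^d)`: it is jointly Gaussian and centered, and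
`𝔼[⟨σ, f⟩ ⟨σ, g⟩] = ⟨A f, g⟩` for all real functions `f`, `g`, where `⟨·,·⟩` is the inner product
of `ℓ²(ℤ_n^d)`. -/
structure IsCenteredGaussian {d n : ℕ} [NeZero n] {Ω : Type*} [MeasurableSpace Ω]
    (P : Measure Ω) (σ : Ω → DTorus d n → ℝ)
    (A : (DTorus d n → ℂ) → DTorus d n → ℂ) : Prop where
  gaussian : HasGaussianLaw σ P
  centered : ∀ x, ∫ ω, σ ω x ∂P = 0
  covariance : ∀ f g : DTorus d n → ℝ,
    ∫ ω, discInner (fun x => (σ ω x : ℂ)) (fun x => (f x : ℂ)) *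
        discInner (fun x => (σ ω x : ℂ)) (fun x => (g x : ℂ)) ∂P
      = discInner (A fun x => (f x : ℂ)) (fun x => (g x : ℂ))

/-! ### The divisible sandpile -/

/-- The initial configuration `s(x) = 1 + σ(x) - n^{-d} ∑_z σ(z)`. -/
def initialConfig {d n : ℕ} [NeZero n] (σ : DTorus d n → ℝ) : DTorus d n → ℝ :=
  fun x => 1 + σ x - ((n : ℝ) ^ d)⁻¹ * ∑ z, σ z

/-- The mass `(η(x) - 1)⁺` emitted from `x` when the unstable vertices of `η` topple. -/
def excess {d n : ℕ} (η : DTorus d n → ℝ) : DTorus d n → ℝ :=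
  fun x => max (η x - 1) 0

/-- One time step: all unstable vertices topple simultaneously, each of them keeping mass `1` and
sending a fraction `1/(2d)` of its excess along each of the `2d` directions `± e_i`. -/
def topple {d n : ℕ} (η : DTorus d n → ℝ) : DTorus d n → ℝ :=
  fun x => η x - excess η x +
    (2 * (d : ℝ))⁻¹ * ∑ i, (excess η (x + Pi.single i 1) + excess η (x - Pi.single i 1))

/-- The mass emitted from `x` in the time step `t`, starting from the configuration `s`. -/
def emission {d n : ℕ} (s : DTorus d n → ℝ) (x : DTorus d n) (t : ℕ) : ℝ :=
  excess (topple^[t] s) x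

/-- The odometer: the total mass emitted from `x` during stabilization. -/
def odometer {d n : ℕ} (s : DTorus d n → ℝ) : DTorus d n → ℝ :=
  fun x => ∑' t, emission s x t

/-! ### The continuum torus -/

/-- The `d`-dimensional torus `𝕋^d = (ℝ/ℤ)^d`; its distance is the `ℓ^∞` distance. -/
abbrev Torus (d : ℕ) : Type := UnitAddTorus (Fin d)

/-- Lebesgue measure on `𝕋^d`, of total mass `1`. -/
def torusMeasure (d : ℕ) : Measure (Torus d) :=
  Measure.pi fun _ => AddCircle.haarAddCircle

instance (d : ℕ) : IsProbabilityMeasure (torusMeasure d) := by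
  unfold torusMeasure; infer_instance

/-- The interpolation `∑_{z ∈ 𝕋_n^d} u(nz) 1_{B(z, 1/(2n))}` of a function `u` on `ℤ_n^d`. -/
def interpolation {d n : ℕ} [NeZero n] (u : DTorus d n → ℝ) : Torus d → ℝ :=
  fun x => ∑ z : DTorus d n, u z *
    (Metric.ball (fun i => ZMod.toAddCircle (z i) : Torus d) (1 / (2 * (n : ℝ)))).indicator
      (fun _ => (1 : ℝ)) x

/-- `f ∈ C^∞(𝕋^d)`, i.e. the corresponding periodic function on `ℝ^d` is smooth. -/
def IsSmooth {d : ℕ} (f : Torus d → ℝ) : Prop :=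
  ContDiff ℝ ((⊤ : ℕ∞) : WithTop ℕ∞)
    (fun x : Fin d → ℝ => f (fun i => (x i : UnitAddCircle)))

/-- The Fourier coefficient `∫ f(z) exp (-2πi ξ·z) dz` of a real function on `𝕋^d`. -/
def fourierCoeff {d : ℕ} (f : Torus d → ℝ) (ξ : Fin d → ℤ) : ℂ :=
  UnitAddTorus.mFourierCoeff (fun x => (f x : ℂ)) ξ

/-- The nonzero frequencies `ℤ^d ∖ {0}`. -/
abbrev Freq (d : ℕ) : Type := {ξ : Fin d → ℤ // ξ ≠ 0}

/-- The frequency `-ξ`. -/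
def Freq.opp {d : ℕ} (ξ : Freq d) : Freq d := ⟨-ξ.1, neg_ne_zero.2 ξ.2⟩

/-- The Euclidean norm of a frequency. -/
def freqNorm {d : ℕ} (ξ : Freq d) : ℝ := Real.sqrt (∑ i, (ξ.1 i : ℝ) ^ 2)

/-- The continuum fractional Laplacian
`(-Δ)^a f(x) = ∑_{ν ≠ 0} ‖ν‖^{2a} f̂(ν) exp (2πi ν·x)`. -/
def fracLaplacian {d : ℕ} (a : ℝ) (f : Torus d → ℝ) (x : Torus d) : ℂ :=
  ∑' ν : Freq d, ((freqNorm ν ^ (2 * a) : ℝ) : ℂ) * fourierCoeff f ν.1 *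
    UnitAddTorus.mFourier ν.1 x

/-! ### The Sobolev space `H^a_K` for the multiplier `K̂(ξ) = ‖ξ‖^{-4s}` -/

/-- The Fourier multiplier `K̂(ξ) = ‖ξ‖^{-4s}`. -/
def multiplier {d : ℕ} (s : ℝ) (ξ : Freq d) : ℝ := freqNorm ξ ^ (-(4 * s))

/-- The weight `K̂(ξ) ‖ξ‖^{4a}`. -/
def weight {d : ℕ} (s a : ℝ) (ξ : Freq d) : ℝ := multiplier s ξ * freqNorm ξ ^ (4 * a)

lemma one_le_freqNorm {d : ℕ} (ξ : Freq d) : 1 ≤ freqNorm ξ := by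
  obtain ⟨i, hi⟩ := Function.ne_iff.1 ξ.2
  refine Real.one_le_sqrt.2 ?_
  have h1 : (1 : ℝ) ≤ (ξ.1 i : ℝ) ^ 2 := by
    have hi' : ξ.1 i ≠ 0 := hi
    have h0 : 0 < (ξ.1 i) ^ 2 := sq_pos_iff.2 hi'
    exact_mod_cast h0
  exact h1.trans (Finset.single_le_sum (f := fun i => (ξ.1 i : ℝ) ^ 2)
    (fun j _ => sq_nonneg _) (Finset.mem_univ i))

lemma weight_pos {d : ℕ} (s a : ℝ) (ξ : Freq d) : 0 < weight s a ξ := by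
  have h := one_le_freqNorm ξ
  have h' : 0 < freqNorm ξ := by linarith
  exact mul_pos (Real.rpow_pos_of_pos h' _) (Real.rpow_pos_of_pos h' _)

lemma weight_opp {d : ℕ} (s a : ℝ) (ξ : Freq d) : weight s a ξ.opp = weight s a ξ := by
  simp [weight, multiplier, freqNorm, Freq.opp]

lemma weight_le_one {d : ℕ} {s a : ℝ} (h : a ≤ s) (ξ : Freq d) : weight s a ξ ≤ 1 := by
  have h1 := one_le_freqNorm ξ
  rw [weight, multiplier, ← Real.rpow_add (by linarith)]
  exact Real.rpow_le_one_of_one_le_of_nonpos h1 (by linarith)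

/-- The square summable families `(v_ξ)` with `v_{-ξ} = conj v_ξ`. -/
def hermitianSubmodule (d : ℕ) : Submodule ℝ (lp (fun _ : Freq d => ℂ) 2) where
  carrier := {v | ∀ ξ : Freq d, v ξ.opp = conj (v ξ)}
  add_mem' := fun hu hv ξ => by simp [hu ξ, hv ξ]
  zero_mem' := fun ξ => by simp
  smul_mem' := fun c v hv ξ => by simp [hv ξ]

/-- The Sobolev space `H^a_K(𝕋^d)` for `K̂(ξ) = ‖ξ‖^{-4s}`, i.e. the Hilbert space completion of
the real mean zero smooth functions under `‖g‖² = ∑_{ξ ≠ 0} K̂(ξ) ‖ξ‖^{4a} |ĝ(ξ)|²`.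
The distribution `g` is stored as the square summable family
`v_ξ = (K̂(ξ) ‖ξ‖^{4a})^{1/2} ĝ(ξ)`. -/
@[nolint unusedArguments]
def SobolevSpace (d : ℕ) (_s _a : ℝ) : Type := hermitianSubmodule d

namespace SobolevSpace

variable {d : ℕ} {s a : ℝ}

instance : NormedAddCommGroup (SobolevSpace d s a) :=
  inferInstanceAs (NormedAddCommGroup (hermitianSubmodule d))

instance : InnerProductSpace ℝ (SobolevSpace d s a) :=
  inferInstanceAs (InnerProductSpace ℝ (hermitianSubmodule d))

instance : MeasurableSpace (SobolevSpace d s a) := borel _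

instance : BorelSpace (SobolevSpace d s a) := ⟨rfl⟩

/-- The Fourier coefficient `ĝ(ξ)` of `g ∈ H^a_K`. -/
def coeff (g : SobolevSpace d s a) (ξ : Freq d) : ℂ :=
  ((Real.sqrt (weight s a ξ))⁻¹ : ℝ) * (g.1 : Freq d → ℂ) ξ

/-- The element of `H^a_K` with given Fourier coefficients. -/
def ofCoeff (c : Freq d → ℂ) (hc : ∀ ξ, c ξ.opp = conj (c ξ))
    (hs : Summable fun ξ => weight s a ξ * ‖c ξ‖ ^ 2) : SobolevSpace d s a :=
  ⟨⟨fun ξ => (Real.sqrt (weight s a ξ) : ℂ) * c ξ, memℓp_gen (by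
    refine hs.congr fun ξ => ?_
    have h := (weight_pos s a ξ).le
    simp only [norm_mul, Complex.norm_real, Real.norm_eq_abs, abs_of_nonneg (Real.sqrt_nonneg _)]
    simp [mul_pow, Real.sq_sqrt h])⟩, fun ξ => by
    simp [weight_opp, hc]⟩

lemma coeff_ofCoeff (c : Freq d → ℂ) (hc : ∀ ξ, c ξ.opp = conj (c ξ))
    (hs : Summable fun ξ => weight s a ξ * ‖c ξ‖ ^ 2) (ξ : Freq d) :
    coeff (ofCoeff (s := s) (a := a) c hc hs) ξ = c ξ := by
  have h := Real.sqrt_ne_zero'.2 (weight_pos s a ξ)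
  change (((Real.sqrt (weight s a ξ))⁻¹ : ℝ) : ℂ) * ((Real.sqrt (weight s a ξ) : ℂ) * c ξ) = c ξ
  rw [← mul_assoc, ← Complex.ofReal_mul, inv_mul_cancel₀ h, Complex.ofReal_one, one_mul]

lemma norm_sq_eq (g : SobolevSpace d s a) :
    ‖g‖ ^ 2 = ∑' ξ, weight s a ξ * ‖coeff g ξ‖ ^ 2 := by
  have h := lp.norm_rpow_eq_tsum (p := 2) (by simp) g.1
  have h' : ‖g‖ ^ 2 = ∑' ξ, ‖(g.1 : Freq d → ℂ) ξ‖ ^ 2 := by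
    change ‖g.1‖ ^ 2 = _
    simpa using h
  rw [h']
  refine tsum_congr fun ξ => ?_
  have hw := weight_pos s a ξ
  rw [coeff, norm_mul, mul_pow, Complex.norm_real, Real.norm_eq_abs, sq_abs, inv_pow,
    Real.sq_sqrt hw.le, ← mul_assoc, mul_inv_cancel₀ hw.ne', one_mul]

instance : CompleteSpace (SobolevSpace d s a) := by
  have hcl : IsClosed (hermitianSubmodule d : Set (lp (fun _ : Freq d => ℂ) 2)) := by
    have : (hermitianSubmodule d : Set (lp (fun _ : Freq d => ℂ) 2)) =
        ⋂ ξ : Freq d, {v | v ξ.opp = conj (v ξ)} := by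
      ext v; simp [hermitianSubmodule]
    rw [this]
    have hev : ∀ ξ : Freq d, Continuous fun v : lp (fun _ : Freq d => ℂ) 2 => v ξ := fun ξ =>
      (lp.evalCLM ℝ (fun _ : Freq d => ℂ) 2 ξ).continuous
    exact isClosed_iInter fun ξ =>
      isClosed_eq (hev _) (Complex.continuous_conj.comp (hev _))
  exact hcl.completeSpace_coe

open Classical in
/-- The element of `H^a_K` given by a function `f` on `𝕋^d` modulo constants: its coefficients are
the `f̂(ξ)`, `ξ ≠ 0` (and `0` if these do not belong to `H^a_K`, which cannot happen for
square integrable `f` and `a ≤ s`). -/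
def ofFun (f : Torus d → ℝ) : SobolevSpace d s a :=
  if h : (∀ ξ : Freq d, fourierCoeff f ξ.opp.1 = conj (fourierCoeff f ξ.1)) ∧
      Summable fun ξ : Freq d => weight s a ξ * ‖fourierCoeff f ξ.1‖ ^ 2
  then ofCoeff (fun ξ => fourierCoeff f ξ.1) h.1 h.2 else 0

/-- The pairing `⟨g, f⟩ = ∑_ξ ĝ(ξ) conj (f̂(ξ))` of `g ∈ H^a_K` with a real mean zero test
function `f` (the sum is real by symmetry). -/
def pairing (f : Torus d → ℝ) (g : SobolevSpace d s a) : ℝ :=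
  ∑' ξ : Freq d, (coeff g ξ * conj (fourierCoeff f ξ.1)).re

end SobolevSpace

lemma fourierCoeff_neg {d : ℕ} (f : Torus d → ℝ) (ξ : Fin d → ℤ) :
    fourierCoeff f (-ξ) = conj (fourierCoeff f ξ) := by
  unfold fourierCoeff UnitAddTorus.mFourierCoeff
  rw [← integral_conj]
  simp [UnitAddTorus.mFourier_neg]

lemma summable_fourierCoeff {d : ℕ} {f : Torus d → ℝ} (hf : MemLp f 2 (torusMeasure d)) :
    Summable fun ξ : Fin d → ℤ => ‖fourierCoeff f ξ‖ ^ 2 := by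
  have hf' : MemLp (fun x => (f x : ℂ)) 2 (torusMeasure d) := hf.ofReal
  have h := (UnitAddTorus.hasSum_sq_mFourierCoeff (d := Fin d) (hf'.toLp _)).summable
  refine h.congr fun ξ => ?_
  have : UnitAddTorus.mFourierCoeff (hf'.toLp _) ξ = fourierCoeff f ξ := by
    unfold fourierCoeff UnitAddTorus.mFourierCoeff
    refine integral_congr_ae ?_
    have := hf'.coeFn_toLp
    filter_upwards [this] with x hx
    rw [hx]
  exact congrArg (fun w : ℂ => ‖w‖ ^ 2) this

lemma memLp_interpolation {d n : ℕ} [NeZero n] (u : DTorus d n → ℝ) (b : ℝ) :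
    MemLp (fun x => b * interpolation u x) 2 (torusMeasure d) := by
  refine MemLp.const_mul ?_ b
  unfold interpolation
  refine memLp_finsetSum _ fun z _ => MemLp.const_mul ?_ _
  exact (memLp_const (1 : ℝ)).indicator Metric.isOpen_ball.measurableSet

lemma SobolevSpace.coeff_ofFun {d : ℕ} {s a : ℝ} (h : a ≤ s) {f : Torus d → ℝ}
    (hf : MemLp f 2 (torusMeasure d)) (ξ : Freq d) :
    (SobolevSpace.ofFun f : SobolevSpace d s a).coeff ξ = fourierCoeff f ξ.1 := by
  have h1 : ∀ ξ : Freq d, fourierCoeff f ξ.opp.1 = conj (fourierCoeff f ξ.1) :=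
    fun ξ => fourierCoeff_neg f ξ.1
  have h2 : Summable fun ξ : Freq d => weight s a ξ * ‖fourierCoeff f ξ.1‖ ^ 2 := by
    refine Summable.of_nonneg_of_le (fun ξ => mul_nonneg (weight_pos s a ξ).le (sq_nonneg _))
      (fun ξ => ?_) ((summable_fourierCoeff hf).comp_injective Subtype.val_injective)
    exact mul_le_of_le_one_left (sq_nonneg _) (weight_le_one h ξ)
  rw [SobolevSpace.ofFun, dif_pos ⟨h1, h2⟩, SobolevSpace.coeff_ofCoeff]

/-- `μ` is a law on `H^a_K` under which `⟨Ξ, f⟩ ∼ 𝒩(0, ‖(-Δ)^{-(s+1)} f‖²_{L²(𝕋^d)})` for every real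
mean zero `f ∈ C^∞(𝕋^d)`. -/
def IsFractionalField {d : ℕ} {s a : ℝ} (μ : Measure (SobolevSpace d s a)) : Prop :=
  ∀ f : Torus d → ℝ, IsSmooth f → ∫ x, f x ∂(torusMeasure d) = 0 →
    μ.map (SobolevSpace.pairing f) =
      gaussianReal 0 (∫ x, ‖fracLaplacian (-(s + 1)) f x‖ ^ 2 ∂(torusMeasure d)).toNNReal

end

end Sandpile

/-! The initial configuration has average mass exactly 1, so stabilization, although nonlinear step
by step, has a linear outcome. A nonnegative supersolution of the toppling equation bounds the
accumulated emissions (`sum_emission_le`), and a shifted solution of the Poisson equation is one, so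
the odometer is finite. The final configuration is at most 1 and mass is conserved, hence it is
identically 1 and the odometer solves a Poisson equation (`odometer_sub_neighborMean`). On the
Fourier side, every nonzero mode of `σ` is divided by `-λ_w` (`discInner_odometer`).

Interpolation multiplies the mode `ξ mod n` by a product of sinc factors
(`fourierCoeff_interpolation`). This product vanishes when `ξ ≠ 0` is congruent to 0 mod `n`, so the
zero mode of the odometer never enters. The rescaled field is therefore a linear image of `σ`, hence
Gaussian.

To stay with real variables, coordinates are taken in the Hartley basis, where a coordinate is the
real part plus the imaginary part of the normalized Fourier coefficient. The discrete Hartley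
functions diagonalize the covariance of `σ`. The covariance of the field at `ξ, η` thus vanishes
unless `ξ ≡ η` mod `n`; on the diagonal it is `weight * sinc² * ρ^(2+2s)` with `ρ = a_n / (-λ_ξ)`.
As `n → ∞` aliasing disappears and `ρ → ‖ξ‖⁻²` (`tendsto_fieldCov`). Moreover `ρ ≤ π²/4` uniformly,
so the standard deviations are at most a constant times `‖ξ‖^(-2s-2ε)`, which is summable because `ε
> d/2` and `s > 0`.

Summable bounds on the first absolute moments make the basis tails uniformly small, so convergence
of finite-dimensional characteristic functions upgrades to convergence in law
(`tendsto_of_charFun_of_summable`). The limit is a random series in the Hartley basis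
(`exists_gaussian`). Pairing with a smooth function is an inner product with a fixed vector, and
these vectors include all finite combinations of the basis, which are dense; this gives uniqueness
(`IsFractionalField.eq`). -/

namespace Sandpile

noncomputable section

/-! ### Characters and Fourier inversion on the discrete torus. -/

section DiscreteFourier

variable {d n : ℕ} [NeZero n]

lemma discChar_comm (w z : DTorus d n) : discChar w z = discChar z w := by
  simp [discChar, mul_comm]

lemma discChar_add (w x y : DTorus d n) : discChar w (x + y) = discChar w x * discChar w y := by
  simp [discChar, add_mul, Finset.sum_add_distrib, AddChar.map_add_eq_mul]

lemma discChar_add_left (w v x : DTorus d n) :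
    discChar (w + v) x = discChar w x * discChar v x := by
  simp [discChar, mul_add, Finset.sum_add_distrib, AddChar.map_add_eq_mul]

lemma discChar_zero (z : DTorus d n) : discChar 0 z = 1 := by
  simp [discChar]

lemma conj_stdAddChar (x : ZMod n) : conj (ZMod.stdAddChar x) = ZMod.stdAddChar (-x) := by
  rw [AddChar.map_neg_eq_conj]

lemma conj_discChar (w z : DTorus d n) : conj (discChar w z) = discChar (-w) z := by
  simp [discChar, conj_stdAddChar]

lemma conj_discChar' (w z : DTorus d n) : conj (discChar w z) = discChar w (-z) := by
  simp [discChar, conj_stdAddChar]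

lemma discChar_single (w : DTorus d n) (i : Fin d) :
    discChar w (Pi.single i 1) = ZMod.stdAddChar (w i) := by
  simp [discChar, Pi.single_apply]

/-- If `w i ≠ 0`, the unit vector `e_i` witnesses that the character is nontrivial, because
`ZMod.stdAddChar` is injective; a nontrivial character sums to zero. -/
lemma sum_discChar (w : DTorus d n) :
    ∑ z, discChar w z = if w = 0 then (n : ℂ) ^ d else 0 := by
  split_ifs with h
  · subst h
    simp [discChar_zero, ZMod.card]
  · obtain ⟨i, hi⟩ := Function.ne_iff.1 h
    let χ : AddChar (DTorus d n) ℂ :=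
      { toFun := discChar w
        map_zero_eq_one' := by simp [discChar]
        map_add_eq_mul' := discChar_add w }
    have hχ : χ ≠ 1 := by
      intro hχ
      have h1 : χ (Pi.single i 1) = 1 := by rw [hχ]; rfl
      have h2 : ZMod.stdAddChar (w i) = ZMod.stdAddChar (0 : ZMod n) := by
        rw [← discChar_single w i, AddChar.map_zero_eq_one]; exact h1
      exact hi (ZMod.injective_stdAddChar h2)
    exact AddChar.sum_eq_zero_of_ne_one hχ

lemma discInner_discChar (w v : DTorus d n) :
    discInner (discChar w) (discChar v) = if w = v then 1 else 0 := by
  have h : ∀ z, discChar w z * conj (discChar v z) = discChar (w - v) z := fun z => by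
    rw [conj_discChar, ← discChar_add_left, sub_eq_add_neg]
  simp only [discInner, h, sum_discChar, sub_eq_zero]
  split_ifs with h
  · exact inv_mul_cancel₀ (pow_ne_zero _ (NeZero.ne _))
  · simp

lemma discInner_add_left (f g h : DTorus d n → ℂ) :
    discInner (fun x => f x + g x) h = discInner f h + discInner g h := by
  simp [discInner, add_mul, Finset.sum_add_distrib, mul_add]

lemma discInner_const_mul_left (c : ℂ) (f h : DTorus d n → ℂ) :
    discInner (fun x => c * f x) h = c * discInner f h := by
  simp only [discInner, mul_assoc, ← Finset.mul_sum]
  ring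

/-- Fourier inversion on the discrete torus. -/
lemma sum_discInner_mul_discChar (f : DTorus d n → ℂ) (x : DTorus d n) :
    ∑ ν, discInner f (discChar ν) * discChar ν x = f x := by
  have h : ∀ ν z, f z * conj (discChar ν z) * discChar ν x = f z * discChar (x - z) ν := by
    intro ν z
    rw [conj_discChar', mul_assoc, ← discChar_add, discChar_comm, neg_add_eq_sub]
  simp only [discInner, mul_assoc, Finset.sum_mul, ← Finset.mul_sum]
  simp only [← mul_assoc, h]
  rw [Finset.sum_comm]
  simp only [← Finset.mul_sum, sum_discChar, sub_eq_zero]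
  have hn : (n : ℂ) ^ d ≠ 0 := pow_ne_zero _ (NeZero.ne _)
  simp only [mul_ite, mul_zero, Finset.sum_ite_eq, Finset.mem_univ, if_true]
  field_simp

end DiscreteFourier

/-! ### Neighbour averaging, its spectrum, and the Poisson equation. -/

section GraphLaplacian

variable {d n : ℕ}

/-- The mean of `f` over the `2d` neighbours of `x`. -/
def neighborMean {𝕜 : Type*} [Field 𝕜] (f : DTorus d n → 𝕜) (x : DTorus d n) : 𝕜 :=
  (2 * (d : 𝕜))⁻¹ * ∑ i, (f (x + Pi.single i 1) + f (x - Pi.single i 1))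

lemma neighborMean_add {𝕜 : Type*} [Field 𝕜] (f g : DTorus d n → 𝕜) (x : DTorus d n) :
    neighborMean (fun y => f y + g y) x = neighborMean f x + neighborMean g x := by
  simp only [neighborMean, ← mul_add, ← Finset.sum_add_distrib]
  congr 1
  exact Finset.sum_congr rfl fun i _ => by ring

lemma neighborMean_const_mul {𝕜 : Type*} [Field 𝕜] (c : 𝕜) (f : DTorus d n → 𝕜)
    (x : DTorus d n) : neighborMean (fun y => c * f y) x = c * neighborMean f x := by
  simp only [neighborMean, ← mul_add, ← Finset.mul_sum]
  ring

lemma neighborMean_sum {𝕜 ι : Type*} [Field 𝕜] (S : Finset ι) (f : ι → DTorus d n → 𝕜)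
    (x : DTorus d n) :
    neighborMean (fun y => ∑ j ∈ S, f j y) x = ∑ j ∈ S, neighborMean (f j) x := by
  simp only [neighborMean, ← Finset.sum_add_distrib, ← Finset.mul_sum]
  rw [Finset.sum_comm]

lemma neighborMean_mono {f g : DTorus d n → ℝ} (h : ∀ x, f x ≤ g x) (x : DTorus d n) :
    neighborMean f x ≤ neighborMean g x :=
  mul_le_mul_of_nonneg_left (Finset.sum_le_sum fun i _ => add_le_add (h _) (h _)) (by positivity)

lemma neighborMean_const {𝕜 : Type*} [Field 𝕜] [CharZero 𝕜] (hd : d ≠ 0) (c : 𝕜)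
    (x : DTorus d n) : neighborMean (fun _ => c) x = c := by
  have : (d : 𝕜) ≠ 0 := Nat.cast_ne_zero.2 hd
  simp only [neighborMean, Finset.sum_const, Finset.card_univ, Fintype.card_fin, nsmul_eq_mul]
  field_simp
  ring

lemma neighborMean_re (f : DTorus d n → ℂ) (x : DTorus d n) :
    neighborMean (fun y => (f y).re) x = (neighborMean f x).re := by
  have h : (2 * (d : ℂ))⁻¹ = ((2 * (d : ℝ))⁻¹ : ℝ) := by push_cast; rfl
  simp [neighborMean, h, -Complex.ofReal_inv, -Complex.ofReal_mul]

lemma neighborMean_ofReal (f : DTorus d n → ℝ) (x : DTorus d n) :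
    neighborMean (fun y => (f y : ℂ)) x = (neighborMean f x : ℝ) := by
  simp [neighborMean]

lemma topple_eq (η : DTorus d n → ℝ) (x : DTorus d n) :
    topple η x = η x - excess η x + neighborMean (excess η) x := rfl

variable [NeZero n]

/-- Averaging is symmetric: translating the summation variable by `e_i` exchanges the two directions
`± e_i`. -/
lemma sum_neighborMean_mul (f g : DTorus d n → ℂ) :
    ∑ x, neighborMean f x * g x = ∑ x, f x * neighborMean g x := by
  have h1 : ∀ i : Fin d, ∑ x, f (x + Pi.single i 1) * g x = ∑ x, f x * g (x - Pi.single i 1) :=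
    fun i => Fintype.sum_equiv (Equiv.addRight (Pi.single i 1)) _ _ fun x => by simp
  have h2 : ∀ i : Fin d, ∑ x, f (x - Pi.single i 1) * g x = ∑ x, f x * g (x + Pi.single i 1) :=
    fun i => Fintype.sum_equiv (Equiv.subRight (Pi.single i 1)) _ _ fun x => by simp
  have hl : ∑ x, neighborMean f x * g x = (2 * (d : ℂ))⁻¹ *
      ∑ i, (∑ x, f (x + Pi.single i 1) * g x + ∑ x, f (x - Pi.single i 1) * g x) := by
    simp only [neighborMean, ← Finset.sum_add_distrib]
    rw [Finset.sum_comm, Finset.mul_sum]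
    refine Finset.sum_congr rfl fun x _ => ?_
    rw [mul_assoc, Finset.sum_mul]
    congr 1
    exact Finset.sum_congr rfl fun i _ => by ring
  have hr : ∑ x, f x * neighborMean g x = (2 * (d : ℂ))⁻¹ *
      ∑ i, (∑ x, f x * g (x - Pi.single i 1) + ∑ x, f x * g (x + Pi.single i 1)) := by
    simp only [neighborMean, ← Finset.sum_add_distrib]
    rw [Finset.sum_comm, Finset.mul_sum]
    refine Finset.sum_congr rfl fun x _ => ?_
    rw [mul_left_comm, Finset.mul_sum]
    congr 1
    exact Finset.sum_congr rfl fun i _ => by ring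
  rw [hl, hr]
  simp only [h1, h2]

lemma sum_neighborMean (hd : d ≠ 0) (f : DTorus d n → ℝ) : ∑ x, neighborMean f x = ∑ x, f x := by
  have h := sum_neighborMean_mul (fun x => (f x : ℂ)) (fun _ => 1)
  simp only [neighborMean_const hd, mul_one, neighborMean_ofReal] at h
  exact_mod_cast h

lemma stdAddChar_add_conj (a : ZMod n) :
    ZMod.stdAddChar a + ZMod.stdAddChar (-a) =
      ((2 - 4 * Real.sin (Real.pi * (a.val : ℝ) / n) ^ 2 : ℝ) : ℂ) := by
  have h : (ZMod.stdAddChar a : ℂ) = Complex.exp ((2 * (Real.pi * (a.val : ℝ) / n) : ℝ) * Complex.I) := by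
    have := ZMod.stdAddChar_coe (N := n) (a.val : ℤ)
    rw [Int.cast_natCast, ZMod.natCast_zmod_val] at this
    rw [this]
    congr 1
    push_cast
    ring
  rw [← conj_stdAddChar, Complex.add_conj, h, Complex.exp_ofReal_mul_I_re, Real.cos_two_mul,
    Real.cos_sq']
  push_cast
  ring

lemma neighborMean_discChar (hd : d ≠ 0) (w x : DTorus d n) :
    neighborMean (discChar w) x = ((1 + eigenvalue w : ℝ) : ℂ) * discChar w x := by
  have h : ∀ i : Fin d, discChar w (x + Pi.single i 1) + discChar w (x - Pi.single i 1) =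
      ((2 - 4 * Real.sin (Real.pi * ((w i).val : ℝ) / n) ^ 2 : ℝ) : ℂ) * discChar w x := fun i => by
    rw [← stdAddChar_add_conj, discChar_add, sub_eq_add_neg, discChar_add, ← conj_discChar',
      discChar_single, conj_stdAddChar]
    ring
  simp only [neighborMean, h, ← Finset.sum_mul, ← mul_assoc]
  congr 1
  have hd' : (d : ℂ) ≠ 0 := Nat.cast_ne_zero.2 hd
  rw [← Complex.ofReal_sum, Finset.sum_sub_distrib, ← Finset.mul_sum, eigenvalue]
  push_cast
  simp only [Finset.sum_const, Finset.card_univ, Fintype.card_fin, nsmul_eq_mul]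
  field_simp
  ring

lemma eigenvalue_neg (w : DTorus d n) : eigenvalue (-w) = eigenvalue w := by
  have h : ∀ a : ZMod n, Real.sin (Real.pi * ((-a).val : ℝ) / n) ^ 2 =
      Real.sin (Real.pi * (a.val : ℝ) / n) ^ 2 := fun a => by
    have h1 := stdAddChar_add_conj a
    have h2 := stdAddChar_add_conj (-a)
    rw [neg_neg, add_comm, h1] at h2
    have := Complex.ofReal_injective h2
    linarith
  simp only [eigenvalue, Pi.neg_apply, h]

lemma discInner_neighborMean (hd : d ≠ 0) (u : DTorus d n → ℂ) (w : DTorus d n) :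
    discInner (neighborMean u) (discChar w) =
      ((1 + eigenvalue w : ℝ) : ℂ) * discInner u (discChar w) := by
  simp only [discInner, conj_discChar]
  have h : ∀ x, neighborMean (fun z => discChar (-w) z) x =
    ((1 + eigenvalue w : ℝ) : ℂ) * discChar (-w) x := fun x => by
      rw [← eigenvalue_neg w]; exact neighborMean_discChar hd (-w) x
  rw [sum_neighborMean_mul]
  simp only [h, mul_left_comm (_ : ℂ) ((1 + eigenvalue w : ℝ) : ℂ), ← Finset.mul_sum]

/-- A spectral gap of the correct order `n⁻²`. One nonzero coordinate suffices, with Jordan's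
inequality `sin x ≥ 2x/π` on `[0, π/2]`. -/
lemma le_neg_eigenvalue {w : DTorus d n} (hw : w ≠ 0) :
    4 / (2 * (d : ℝ)) * (2 / n) ^ 2 ≤ -eigenvalue w := by
  obtain ⟨i, hi⟩ := Function.ne_iff.1 hw
  have hi : w i ≠ 0 := hi
  have hn : (0 : ℝ) < n := Nat.cast_pos.2 (Nat.pos_of_ne_zero (NeZero.ne n))
  have hk : 1 ≤ (w i).val := Nat.one_le_iff_ne_zero.2 (by rwa [Ne, ZMod.val_eq_zero])
  have hk' : (w i).val + 1 ≤ n := ZMod.val_lt _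
  set k : ℝ := ((w i).val : ℝ) with hkdef
  have hk1 : (1 : ℝ) ≤ k := Nat.one_le_cast.2 hk
  have hk2 : k + 1 ≤ n := by rw [hkdef]; exact_mod_cast hk'
  have key : ∀ t : ℝ, 1 ≤ t → t ≤ n / 2 → 2 / (n : ℝ) ≤ Real.sin (Real.pi * t / n) := by
    intro t h1 h2
    have hx : Real.pi * t / n ≤ Real.pi / 2 := by
      rw [div_le_div_iff₀ hn two_pos]
      nlinarith [Real.pi_pos]
    have h0 : 0 ≤ Real.pi * t / n := by positivity
    refine le_trans ?_ (Real.mul_le_sin h0 hx)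
    rw [show 2 / Real.pi * (Real.pi * t / n) = 2 * t / n by field_simp]
    gcongr
    linarith
  have hsin : 2 / (n : ℝ) ≤ Real.sin (Real.pi * k / n) := by
    -- Residues beyond `n/2` are reflected to `n - k`, which is still at least 1.
    rcases le_total k (n / 2) with h | h
    · exact key k hk1 h
    · have := key (n - k) (by linarith) (by linarith)
      rwa [show Real.pi * (n - k) / n = Real.pi - Real.pi * k / n by field_simp, Real.sin_pi_sub]
        at this
  have h1 : (2 / (n : ℝ)) ^ 2 ≤ ∑ i, Real.sin (Real.pi * ((w i).val : ℝ) / n) ^ 2 :=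
    (pow_le_pow_left₀ (by positivity) hsin 2).trans
      (Finset.single_le_sum (f := fun i => Real.sin (Real.pi * ((w i).val : ℝ) / n) ^ 2)
        (fun j _ => sq_nonneg _) (Finset.mem_univ i))
  rw [eigenvalue, neg_mul, neg_neg]
  exact mul_le_mul_of_nonneg_left h1 (by positivity)

lemma neg_eigenvalue_pos (hd : d ≠ 0) {w : DTorus d n} (hw : w ≠ 0) : 0 < -eigenvalue w := by
  have : 0 < d := Nat.pos_of_ne_zero hd
  have : 0 < n := Nat.pos_of_ne_zero (NeZero.ne n)
  exact lt_of_lt_of_le (by positivity) (le_neg_eigenvalue hw)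

/-- The Poisson equation on the discrete torus is solvable for data of mean zero. -/
lemma exists_sub_neighborMean_eq (hd : d ≠ 0) (g : DTorus d n → ℝ) (hg : ∑ x, g x = 0) :
    ∃ f : DTorus d n → ℝ, ∀ x, f x - neighborMean f x = g x := by
  -- Invert the Laplacian mode by mode. The zero mode of the solution is free and set to 0; that of
  -- `g` vanishes by `hg`. The real part is taken afterwards, which is harmless since averaging has
  -- real coefficients.
  set F : DTorus d n → ℂ := fun x => ∑ ν, (if ν = 0 then 0 else ((-eigenvalue ν : ℝ) : ℂ)⁻¹ *
    discInner (fun x => (g x : ℂ)) (discChar ν)) * discChar ν x with hF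
  refine ⟨fun x => (F x).re, fun x => ?_⟩
  have h0 : discInner (fun x => (g x : ℂ)) (discChar 0) = 0 := by
    simp only [discInner, discChar_zero, map_one, mul_one]
    rw [← Complex.ofReal_sum, hg]
    simp
  have h : F x - neighborMean F x = g x := by
    rw [hF, neighborMean_sum, ← Finset.sum_sub_distrib,
      ← sum_discInner_mul_discChar (fun x => (g x : ℂ)) x]
    refine Finset.sum_congr rfl fun ν _ => ?_
    rw [neighborMean_const_mul, neighborMean_discChar hd]
    split_ifs with hν
    · subst hν
      simp [h0]
    · have h1 : ((-eigenvalue ν : ℝ) : ℂ) ≠ 0 :=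
        Complex.ofReal_ne_zero.2 (neg_eigenvalue_pos hd hν).ne'
      have h2 : ((1 + eigenvalue ν : ℝ) : ℂ) = 1 - ((-eigenvalue ν : ℝ) : ℂ) := by
        push_cast; ring
      rw [h2]
      field_simp
      ring
  rw [neighborMean_re, ← Complex.sub_re, h, Complex.ofReal_re]

end GraphLaplacian

/-! ### Finiteness of the odometer and the equation it solves. -/

section Odometer

variable {d n : ℕ}

lemma emission_nonneg (s : DTorus d n → ℝ) (x : DTorus d n) (t : ℕ) : 0 ≤ emission s x t :=
  le_max_right _ _

/-- One step is linear in the emitted mass, so the history enters only through the accumulated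
emissions. -/
lemma topple_iterate (s : DTorus d n → ℝ) (t : ℕ) (x : DTorus d n) :
    topple^[t] s x = s x - ∑ k ∈ Finset.range t, emission s x k +
      neighborMean (fun y => ∑ k ∈ Finset.range t, emission s y k) x := by
  induction t generalizing x with
  | zero => simp [neighborMean]
  | succ t ih =>
    simp only [Function.iterate_succ_apply', topple_eq, Finset.sum_range_succ, neighborMean_add]
    rw [ih x]
    change _ - emission s x t + neighborMean (fun y => emission s y t) x = _
    ring

/-- The least action principle for parallel toppling. -/
lemma sum_emission_le (s f : DTorus d n → ℝ) (hf0 : ∀ x, 0 ≤ f x)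
    (hf : ∀ x, s x - 1 + neighborMean f x ≤ f x) (t : ℕ) (x : DTorus d n) :
    ∑ k ∈ Finset.range t, emission s x k ≤ f x := by
  induction t generalizing x with
  | zero => simpa using hf0 x
  | succ t ih =>
    rw [Finset.sum_range_succ, emission, excess, topple_iterate]
    -- If `x` topples, its new accumulated emission is `s x - 1` plus the neighbour mean of the old
    -- ones, which the induction hypothesis and `hf` bound by `f x`. Otherwise nothing changes at
    -- `x`.
    rcases max_cases (s x - ∑ k ∈ Finset.range t, emission s x k +
      neighborMean (fun y => ∑ k ∈ Finset.range t, emission s y k) x - 1) 0 with h | h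
    · rw [h.1]
      have := neighborMean_mono ih x
      linarith [hf x]
    · rw [h.1, add_zero]
      exact ih x

variable [NeZero n]

/-- A Poisson solution minus its lower bound is nonnegative and still solves the equation, so it
dominates all partial sums of emissions. -/
lemma summable_emission (hd : d ≠ 0) (s : DTorus d n → ℝ) (hs : ∑ x, (s x - 1) = 0)
    (x : DTorus d n) : Summable (emission s x) := by
  obtain ⟨f, hf⟩ := exists_sub_neighborMean_eq hd (fun x => s x - 1) hs
  obtain ⟨m, hm⟩ : ∃ m, ∀ x, m ≤ f x := (Set.finite_range f).bddBelow.imp fun m hm x => hm ⟨x, rfl⟩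
  have key := sum_emission_le s (fun x => f x + -m) (fun x => by linarith [hm x]) (fun x => by
    rw [neighborMean_add, neighborMean_const hd]
    linarith [hf x])
  exact summable_of_sum_range_le (emission_nonneg s x) fun t => key t x

lemma tendsto_sum_emission (hd : d ≠ 0) (s : DTorus d n → ℝ) (hs : ∑ x, (s x - 1) = 0)
    (x : DTorus d n) :
    Tendsto (fun t => ∑ k ∈ Finset.range t, emission s x k) atTop (𝓝 (odometer s x)) :=
  (summable_emission hd s hs x).hasSum.tendsto_sum_nat

/-- The final configuration is identically `1`. -/
lemma odometer_sub_neighborMean (hd : d ≠ 0) (s : DTorus d n → ℝ) (hs : ∑ x, (s x - 1) = 0)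
    (x : DTorus d n) : odometer s x - neighborMean (odometer s) x = s x - 1 := by
  -- The excess is a term of a convergent series, so it tends to 0 and the limiting configuration is
  -- at most 1.
  have hle : ∀ x, s x - 1 - odometer s x + neighborMean (odometer s) x ≤ 0 := fun x => by
    have h1 : Tendsto (fun t => topple^[t] s x - 1) atTop
        (𝓝 (s x - odometer s x + neighborMean (odometer s) x - 1)) := by
      simp only [topple_iterate]
      refine ((tendsto_const_nhds.sub (tendsto_sum_emission hd s hs x)).add ?_).sub_const 1
      exact (tendsto_finsetSum _ fun i _ => (tendsto_sum_emission hd s hs _).add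
        (tendsto_sum_emission hd s hs _)).const_mul _
    have h2 : Tendsto (emission s x) atTop (𝓝 0) := (summable_emission hd s hs x).tendsto_atTop_zero
    have h3 := le_of_tendsto_of_tendsto' h1 h2 fun t => le_max_left _ _
    linarith
  -- Conservation of mass: a nonpositive function with sum zero vanishes.
  have hsum : ∑ x, (s x - 1 - odometer s x + neighborMean (odometer s) x) = 0 := by
    rw [Finset.sum_add_distrib, Finset.sum_sub_distrib, sum_neighborMean hd, hs]
    ring
  have := (Finset.sum_eq_zero_iff_of_nonpos fun x _ => hle x).1 hsum x (Finset.mem_univ x)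
  linarith

lemma sum_initialConfig_sub_one (σ : DTorus d n → ℝ) : ∑ x, (initialConfig σ x - 1) = 0 := by
  have hn : (n : ℝ) ^ d ≠ 0 := pow_ne_zero _ (NeZero.ne _)
  have h : ∀ x, initialConfig σ x - 1 = σ x - ((n : ℝ) ^ d)⁻¹ * ∑ z, σ z := fun x => by
    rw [initialConfig]; ring
  simp only [h, Finset.sum_sub_distrib, Finset.sum_const, Finset.card_univ, Fintype.card_pi,
    ZMod.card, Finset.prod_const, Fintype.card_fin, nsmul_eq_mul]
  push_cast
  field_simp
  ring

lemma discInner_odometer (hd : d ≠ 0) (σ : DTorus d n → ℝ) {w : DTorus d n} (hw : w ≠ 0) :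
    discInner (fun x => (odometer (initialConfig σ) x : ℂ)) (discChar w) =
      ((-eigenvalue w)⁻¹ : ℝ) * discInner (fun x => (σ x : ℂ)) (discChar w) := by
  set u : DTorus d n → ℂ := fun x => (odometer (initialConfig σ) x : ℂ) with hu
  -- The subtracted average is a multiple of the trivial character, hence invisible to the mode `w ≠
  -- 0`.
  set c : ℂ := -(((n : ℝ) ^ d)⁻¹ * ∑ z, σ z : ℝ)
  have h1 : ∀ x, u x + (-1) * neighborMean u x = (σ x : ℂ) + c * discChar 0 x := fun x => by
    have := odometer_sub_neighborMean hd (initialConfig σ) (sum_initialConfig_sub_one σ) x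
    rw [hu, neighborMean_ofReal, discChar_zero]
    have h2 : odometer (initialConfig σ) x + (-1) * neighborMean (odometer (initialConfig σ)) x =
      σ x + -(((n : ℝ) ^ d)⁻¹ * ∑ z, σ z) * 1 := by
      rw [initialConfig] at this
      linarith
    have h3 := congrArg (fun r : ℝ => (r : ℂ)) h2
    simp only [Complex.ofReal_add, Complex.ofReal_mul] at h3
    simpa [c] using h3
  have h2 : discInner (fun x => u x + (-1) * neighborMean u x) (discChar w) =
      discInner (fun x => (σ x : ℂ) + c * discChar 0 x) (discChar w) := by
    simp only [h1]
  rw [discInner_add_left, discInner_add_left, discInner_const_mul_left, discInner_const_mul_left,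
    discInner_discChar, if_neg hw.symm, discInner_neighborMean hd] at h2
  have h3 : ((-eigenvalue w : ℝ) : ℂ) ≠ 0 := Complex.ofReal_ne_zero.2 (neg_eigenvalue_pos hd hw).ne'
  rw [Complex.ofReal_inv, eq_inv_mul_iff_mul_eq₀ h3]
  rw [mul_zero, add_zero] at h2
  rw [← h2]
  push_cast
  ring

end Odometer

/-! ### Fourier coefficients of the piecewise constant interpolation. -/

section Interpolation

lemma integral_exp_symm (k : ℤ) (n : ℕ) (hn : n ≠ 0) :
    ∫ t in (-(1 / (2 * (n : ℝ))))..(1 / (2 * (n : ℝ))),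
        Complex.exp ((-2 * Real.pi * Complex.I * k) * (t : ℂ)) =
      (((n : ℝ)⁻¹ * Real.sinc (Real.pi * k / n) : ℝ) : ℂ) := by
  have hn' : (n : ℝ) ≠ 0 := Nat.cast_ne_zero.2 hn
  by_cases hk : k = 0
  · subst hk
    simp [← two_mul]
    field_simp
  · have hk' : (k : ℝ) ≠ 0 := Int.cast_ne_zero.2 hk
    have hkC : (k : ℂ) ≠ 0 := Int.cast_ne_zero.2 hk
    have hnC : (n : ℂ) ≠ 0 := Nat.cast_ne_zero.2 hn
    have hpi : (Real.pi : ℂ) ≠ 0 := Complex.ofReal_ne_zero.2 Real.pi_ne_zero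
    have hc : (-2 * Real.pi * Complex.I * k : ℂ) ≠ 0 := by
      simp [Real.pi_ne_zero, hk]
    rw [integral_exp_mul_complex hc, Real.sinc_of_ne_zero (by positivity)]
    have e1 : (-2 * Real.pi * Complex.I * k : ℂ) * ((1 / (2 * (n : ℝ)) : ℝ) : ℂ) =
        ((-(Real.pi * k / n) : ℝ) : ℂ) * Complex.I := by
      push_cast; field_simp
    have e2 : (-2 * Real.pi * Complex.I * k : ℂ) * ((-(1 / (2 * (n : ℝ))) : ℝ) : ℂ) =
        ((Real.pi * k / n : ℝ) : ℂ) * Complex.I := by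
      push_cast; field_simp
    rw [e1, e2, Complex.exp_mul_I, Complex.exp_mul_I, Complex.ofReal_neg, Complex.cos_neg,
      Complex.sin_neg]
    push_cast
    field_simp
    ring

lemma norm_coe_lt_iff {t ρ : ℝ} (h1 : -(1 / 2) < t) (h2 : t ≤ 1 / 2) :
    ‖(t : UnitAddCircle)‖ < ρ ↔ |t| < ρ := by
  rw [(AddCircle.norm_coe_eq_abs_iff (p := 1) (x := t) one_ne_zero).2]
  rw [abs_one]
  exact abs_le.2 ⟨h1.le, h2⟩

/-- On the fundamental domain `(-1/2, 1/2]` the quotient norm is the absolute value, so the ball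
lifts to the interval `(-1/(2n), 1/(2n))`, also when `n = 1`. -/
lemma integral_ball_zero_fourier (k : ℤ) (n : ℕ) (hn : n ≠ 0) :
    ∫ x : UnitAddCircle, (Metric.ball (0 : UnitAddCircle) (1 / (2 * (n : ℝ)))).indicator
        (fun x => fourier (-k) x) x ∂AddCircle.haarAddCircle =
      (((n : ℝ)⁻¹ * Real.sinc (Real.pi * k / n) : ℝ) : ℂ) := by
  have hn' : (1 : ℝ) ≤ n := Nat.one_le_cast.2 (Nat.one_le_iff_ne_zero.2 hn)
  have hρ : 1 / (2 * (n : ℝ)) ≤ 1 / 2 := by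
    apply one_div_le_one_div_of_le <;> linarith
  have hρ0 : 0 < 1 / (2 * (n : ℝ)) := by positivity
  have hv : (AddCircle.haarAddCircle : Measure UnitAddCircle) = volume := by
    rw [AddCircle.volume_eq_smul_haarAddCircle, ENNReal.ofReal_one, one_smul]
  rw [hv, ← AddCircle.integral_preimage (1 : ℝ) (-(1 / 2)), ← integral_exp_symm k n hn,
    intervalIntegral.integral_of_le (by linarith),
    integral_Ioc_eq_integral_Ioo (x := -(1 / (2 * (n : ℝ))))]
  have h1 : ∀ t ∈ Set.Ioc (-(1 / 2) : ℝ) (-(1 / 2) + 1),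
      (Metric.ball (0 : UnitAddCircle) (1 / (2 * (n : ℝ)))).indicator
        (fun x => fourier (-k) x) (t : UnitAddCircle) =
      (Set.Ioo (-(1 / (2 * (n : ℝ)))) (1 / (2 * (n : ℝ)))).indicator
        (fun t : ℝ => Complex.exp ((-2 * Real.pi * Complex.I * k) * (t : ℂ))) t := by
    intro t ht
    have hmem : (t : UnitAddCircle) ∈ Metric.ball (0 : UnitAddCircle) (1 / (2 * (n : ℝ))) ↔
        t ∈ Set.Ioo (-(1 / (2 * (n : ℝ)))) (1 / (2 * (n : ℝ))) := by
      rw [mem_ball_zero_iff, norm_coe_lt_iff ht.1 (by linarith [ht.2]), abs_lt, Set.mem_Ioo]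
    by_cases h : t ∈ Set.Ioo (-(1 / (2 * (n : ℝ)))) (1 / (2 * (n : ℝ)))
    · rw [Set.indicator_of_mem h, Set.indicator_of_mem (hmem.2 h), fourier_coe_apply]
      congr 1
      push_cast
      ring
    · rw [Set.indicator_of_notMem h, Set.indicator_of_notMem (mt hmem.1 h)]
  rw [setIntegral_congr_fun measurableSet_Ioc h1, setIntegral_indicator measurableSet_Ioo]
  congr 2
  rw [Set.inter_eq_right]
  exact fun t ht => ⟨by linarith [ht.1], by linarith [ht.2]⟩

lemma integral_ball_fourier (c : UnitAddCircle) (k : ℤ) (n : ℕ) (hn : n ≠ 0) :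
    ∫ x : UnitAddCircle, (Metric.ball c (1 / (2 * (n : ℝ)))).indicator
        (fun x => fourier (-k) x) x ∂AddCircle.haarAddCircle =
      fourier (-k) c * (((n : ℝ)⁻¹ * Real.sinc (Real.pi * k / n) : ℝ) : ℂ) := by
  rw [← integral_ball_zero_fourier k n hn, ← integral_const_mul,
    ← integral_add_left_eq_self _ c]
  congr 1
  ext x
  have hmem : c + x ∈ Metric.ball c (1 / (2 * (n : ℝ))) ↔ x ∈ Metric.ball 0 (1 / (2 * (n : ℝ))) := by
    simp [dist_eq_norm]
  by_cases h : x ∈ Metric.ball 0 (1 / (2 * (n : ℝ)))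
  · rw [Set.indicator_of_mem h, Set.indicator_of_mem (hmem.2 h)]
    simp [fourier_apply, smul_add, AddCircle.toCircle_add]
  · rw [Set.indicator_of_notMem h, Set.indicator_of_notMem (mt hmem.1 h), mul_zero]

variable {d n : ℕ} [NeZero n]

/-- The frequency `ξ` modulo `n`. -/
def freqMod (n : ℕ) (ξ : Fin d → ℤ) : DTorus d n := fun i => (ξ i : ZMod n)

/-- The Fourier multiplier of the indicator of a cube of side `1/n`. -/
def sincProd (n : ℕ) (ξ : Fin d → ℤ) : ℝ := ∏ i, Real.sinc (Real.pi * ξ i / n)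

lemma fourier_toAddCircle (k : ℤ) (j : ZMod n) :
    fourier (-k) (ZMod.toAddCircle j) = conj (ZMod.stdAddChar (j * (k : ZMod n))) := by
  have h : j * (k : ZMod n) = (((j.val : ℤ) * k : ℤ) : ZMod n) := by
    push_cast
    rw [ZMod.natCast_zmod_val]
  rw [h, ZMod.stdAddChar_coe, fourier_neg, ZMod.toAddCircle_apply, fourier_coe_apply]
  congr 2
  push_cast
  ring

lemma fourierCoeff_eq_integral (f : Torus d → ℝ) (ξ : Fin d → ℤ) :
    fourierCoeff f ξ = ∫ x, UnitAddTorus.mFourier (-ξ) x * (f x : ℂ) ∂torusMeasure d := rfl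

lemma stdAddChar_sum {ι : Type*} (S : Finset ι) (g : ι → ZMod n) :
    (ZMod.stdAddChar (∑ i ∈ S, g i) : ℂ) = ∏ i ∈ S, ZMod.stdAddChar (g i) := by
  classical
  induction S using Finset.induction_on with
  | empty => simp
  | insert a S ha ih => simp [Finset.sum_insert ha, Finset.prod_insert ha, AddChar.map_add_eq_mul, ih]

/-- A ball of the sup metric is a product of arcs, so the integral factors over the coordinates. -/
lemma integral_ball_mFourier (ξ : Fin d → ℤ) (z : DTorus d n) :
    ∫ x, UnitAddTorus.mFourier (-ξ) x *
        (((Metric.ball (fun i => ZMod.toAddCircle (z i) : Torus d) (1 / (2 * (n : ℝ)))).indicator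
          (fun _ => (1 : ℝ)) x : ℝ) : ℂ) ∂torusMeasure d =
      ((n : ℂ) ^ d)⁻¹ * sincProd n ξ * conj (discChar (freqMod n ξ) z) := by
  have hn : n ≠ 0 := NeZero.ne n
  have hρ0 : 0 < 1 / (2 * (n : ℝ)) := by
    have : 0 < n := Nat.pos_of_ne_zero hn
    positivity
  have h : ∀ x : Torus d, UnitAddTorus.mFourier (-ξ) x *
        (((Metric.ball (fun i => ZMod.toAddCircle (z i) : Torus d) (1 / (2 * (n : ℝ)))).indicator
          (fun _ => (1 : ℝ)) x : ℝ) : ℂ) =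
      ∏ i, (Metric.ball (ZMod.toAddCircle (z i)) (1 / (2 * (n : ℝ)))).indicator
        (fun x => (fourier (-ξ i) x : ℂ)) (x i) := by
    intro x
    rw [ball_pi _ hρ0]
    by_cases hx : x ∈ Set.pi Set.univ
        (fun i => Metric.ball (ZMod.toAddCircle (z i)) (1 / (2 * (n : ℝ))))
    · rw [Set.indicator_of_mem hx, Complex.ofReal_one, mul_one]
      change ∏ i, fourier ((-ξ) i) (x i) = _
      refine Finset.prod_congr rfl fun i _ => ?_
      rw [Set.indicator_of_mem (hx i (Set.mem_univ i))]
      rfl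
    · rw [Set.indicator_of_notMem hx, Complex.ofReal_zero, mul_zero]
      obtain ⟨i, hi⟩ : ∃ i, x i ∉ Metric.ball (ZMod.toAddCircle (z i)) (1 / (2 * (n : ℝ))) := by
        by_contra! hcon
        exact hx fun i _ => hcon i
      exact (Finset.prod_eq_zero (Finset.mem_univ i) (Set.indicator_of_notMem hi _)).symm
  simp only [h, torusMeasure]
  rw [integral_fintype_prod_eq_prod (𝕜 := ℂ)
    (fun i x => (Metric.ball (ZMod.toAddCircle (z i)) (1 / (2 * (n : ℝ)))).indicator
        (fun x => (fourier (-ξ i) x : ℂ)) x)]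
  simp only [integral_ball_fourier _ _ n hn, fourier_toAddCircle, Finset.prod_mul_distrib]
  rw [← map_prod, ← Complex.ofReal_prod, Finset.prod_mul_distrib, discChar, stdAddChar_sum]
  simp [sincProd, freqMod]
  ring

/-- The Fourier coefficients of the piecewise constant interpolation. -/
lemma fourierCoeff_interpolation (b : ℝ) (u : DTorus d n → ℝ) (ξ : Fin d → ℤ) :
    fourierCoeff (fun x => b * interpolation u x) ξ =
      ((b * sincProd n ξ : ℝ) : ℂ) *
        discInner (fun x => (u x : ℂ)) (discChar (freqMod n ξ)) := by
  have hint : ∀ z : DTorus d n, Integrable (fun x => UnitAddTorus.mFourier (-ξ) x *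
        (((Metric.ball (fun i => ZMod.toAddCircle (z i) : Torus d) (1 / (2 * (n : ℝ)))).indicator
          (fun _ => (1 : ℝ)) x : ℝ) : ℂ)) (torusMeasure d) := by
    intro z
    have h1 : Integrable (fun x => (((Metric.ball (fun i => ZMod.toAddCircle (z i) : Torus d)
        (1 / (2 * (n : ℝ)))).indicator (fun _ => (1 : ℝ)) x : ℝ) : ℂ)) (torusMeasure d) :=
      ((integrable_const (1 : ℝ)).indicator Metric.isOpen_ball.measurableSet).ofReal
    refine h1.bdd_mul (c := 1)
      (UnitAddTorus.mFourier (-ξ)).continuous.aestronglyMeasurable (.of_forall fun x => ?_)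
    exact (ContinuousMap.norm_coe_le_norm _ _).trans UnitAddTorus.mFourier_norm.le
  rw [fourierCoeff_eq_integral]
  have h : ∀ x : Torus d, UnitAddTorus.mFourier (-ξ) x * ((b * interpolation u x : ℝ) : ℂ) =
      ∑ z : DTorus d n, ((b * u z : ℝ) : ℂ) * (UnitAddTorus.mFourier (-ξ) x *
        (((Metric.ball (fun i => ZMod.toAddCircle (z i) : Torus d) (1 / (2 * (n : ℝ)))).indicator
          (fun _ => (1 : ℝ)) x : ℝ) : ℂ)) := by
    intro x
    rw [interpolation, Finset.mul_sum, Complex.ofReal_sum, Finset.mul_sum]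
    refine Finset.sum_congr rfl fun z _ => ?_
    push_cast
    ring
  simp only [h]
  rw [integral_finsetSum _ fun z _ => (hint z).const_mul _]
  simp only [integral_const_mul, integral_ball_mFourier, discInner, Finset.mul_sum]
  refine Finset.sum_congr rfl fun z _ => ?_
  push_cast
  ring

/-- A nonzero coordinate divisible by `n` puts a zero of the sine into the product. This keeps the
zero mode of the odometer, which `discInner_odometer` does not cover, out of the field. -/
lemma sincProd_eq_zero {ξ : Fin d → ℤ} (hξ : ξ ≠ 0) (h : freqMod n ξ = 0) : sincProd n ξ = 0 := by
  obtain ⟨i, hi⟩ := Function.ne_iff.1 hξ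
  have hi : ξ i ≠ 0 := hi
  have hn : (n : ℝ) ≠ 0 := Nat.cast_ne_zero.2 (NeZero.ne n)
  obtain ⟨m, hm⟩ := (ZMod.intCast_zmod_eq_zero_iff_dvd (ξ i) n).1 (congrFun h i)
  refine Finset.prod_eq_zero (Finset.mem_univ i) ?_
  have e : Real.pi * ξ i / n = m * Real.pi := by
    rw [hm]; push_cast; field_simp
  have hm0 : (m : ℝ) ≠ 0 := by
    rintro h0
    have : m = 0 := by exact_mod_cast h0
    exact hi (by rw [hm, this, mul_zero])
  rw [e, Real.sinc_of_ne_zero (mul_ne_zero hm0 Real.pi_ne_zero), Real.sin_int_mul_pi, zero_div]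

lemma abs_sincProd_le_one (n : ℕ) (ξ : Fin d → ℤ) : |sincProd n ξ| ≤ 1 := by
  rw [sincProd, Finset.abs_prod]
  exact Finset.prod_le_one (fun i _ => abs_nonneg _) fun i _ => Real.abs_sinc_le_one _

lemma tendsto_div_natCast (c : ℝ) : Tendsto (fun n : ℕ => c / n) atTop (𝓝 0) :=
  tendsto_const_nhds.div_atTop tendsto_natCast_atTop_atTop

lemma tendsto_sincProd (ξ : Fin d → ℤ) : Tendsto (fun n => sincProd n ξ) atTop (𝓝 1) := by
  have h : ∀ i, Tendsto (fun n : ℕ => Real.sinc (Real.pi * ξ i / n)) atTop (𝓝 1) := fun i => by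
    have := (Real.continuous_sinc.tendsto 0).comp (tendsto_div_natCast (Real.pi * ξ i))
    rwa [Real.sinc_zero] at this
  simpa [sincProd] using tendsto_finsetProd Finset.univ fun i _ => h i

end Interpolation

/-! ### Gaussian series and convergence in law in a Hilbert space. -/

section GaussianHilbert

variable {ι H : Type*} [NormedAddCommGroup H] [InnerProductSpace ℝ H]

lemma summable_pow_two {κ : Type*} {f : κ → ℝ} (h : Summable fun i => ‖f i‖) :
    Summable fun i => f i ^ 2 := by
  have h1 : Summable fun i => ‖f i‖ ^ 2 := by
    refine (summable_norm_iff.1 h).abs.of_norm_bounded_eventually ?_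
    filter_upwards [h.tendsto_cofinite_zero.eventually (ge_mem_nhds one_pos)] with i hi
    rw [Real.norm_of_nonneg (by positivity), sq]
    exact mul_le_of_le_one_left (norm_nonneg _) hi
  simpa using h1

lemma ae_summable_of_summable_lintegral [Countable ι] {Ω : Type*} [MeasurableSpace Ω] {P : Measure Ω}
    {Y : ι → Ω → ℝ} (hY : ∀ i, AEMeasurable (Y i) P)
    (h : ∑' i, ∫⁻ ω, ‖Y i ω‖ₑ ∂P ≠ ∞) : ∀ᵐ ω ∂P, Summable fun i => ‖Y i ω‖ := by
  rw [← lintegral_tsum fun i => (hY i).enorm] at h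
  filter_upwards [ae_lt_top' (AEMeasurable.tsum fun i => (hY i).enorm) h] with ω hω
  have := ENNReal.summable_toReal hω.ne
  simpa using this

lemma map_sum_gaussian (a : ι → ℝ) (S : Finset ι) :
    (Measure.infinitePi fun _ : ι => gaussianReal 0 1).map (fun ω => ∑ i ∈ S, a i * ω i) =
      gaussianReal 0 (∑ i ∈ S, a i ^ 2).toNNReal := by
  classical
  set P := Measure.infinitePi fun _ : ι => gaussianReal 0 1
  have hind : iIndepFun (fun i (ω : ι → ℝ) => a i * ω i) P :=
    iIndepFun_infinitePi (P := fun _ : ι => gaussianReal 0 1) (X := fun i x => a i * x)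
      fun i => by fun_prop
  have hlaw : ∀ i, P.map (fun ω => a i * ω i) = gaussianReal 0 (a i ^ 2).toNNReal := by
    intro i
    have h1 : (fun ω : ι → ℝ => a i * ω i) = (fun x => a i * x) ∘ Function.eval i := rfl
    rw [h1, ← Measure.map_map (by fun_prop) (by fun_prop),
      (measurePreserving_eval_infinitePi (fun _ : ι => gaussianReal 0 1) i).map_eq,
      gaussianReal_map_const_mul]
    congr 1
    · simp
    · ext; simp [sq_nonneg]
  induction S using Finset.induction_on with
  | empty =>
    simp
  | insert j S hj ih =>
    have hi : IndepFun (fun ω : ι → ℝ => a j * ω j) (fun ω => ∑ i ∈ S, a i * ω i) P := by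
      have := hind.indepFun_finsetSum_of_notMem (fun i => by fun_prop) hj
      simpa [Finset.sum_fn] using this.symm
    simp only [Finset.sum_insert hj]
    have := gaussianReal_add_gaussianReal_of_indepFun hi (hlaw j) ih
    rw [show (fun ω : ι → ℝ => a j * ω j + ∑ i ∈ S, a i * ω i) =
      (fun ω => a j * ω j) + fun ω => ∑ i ∈ S, a i * ω i from rfl, this, add_zero,
      Real.toNNReal_add (sq_nonneg _) (Finset.sum_nonneg fun i _ => sq_nonneg _)]

/-- The partial sums of the inner product are centered Gaussian with convergent variances. Their
characteristic functions converge both to the Gaussian one and, by dominated convergence, to that of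
the limit. -/
lemma map_inner_gaussian_series [Countable ι] [MeasurableSpace H] [BorelSpace H]
    [CompleteSpace H] {Ω : Type*} [MeasurableSpace Ω]
    {P : Measure Ω} [IsProbabilityMeasure P] (b : HilbertBasis ι ℝ H) {c : ι → ℝ}
    (hc : Summable fun i => |c i|) {g : ι → Ω → ℝ} (hg : ∀ i, Measurable (g i))
    (hlaw : ∀ (a : ι → ℝ) (S : Finset ι), P.map (fun ω => ∑ i ∈ S, a i * g i ω) =
      gaussianReal 0 (∑ i ∈ S, a i ^ 2).toNNReal) {X : Ω → H} (hXm : AEMeasurable X P)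
    (hX : ∀ᵐ ω ∂P, HasSum (fun i => (c i * g i ω) • b i) (X ω)) (t : H) :
    (P.map X).map (fun x => inner ℝ t x) =
      gaussianReal 0 (∑' i, (c i * inner ℝ (b i) t) ^ 2).toNNReal := by
  have hprob : IsProbabilityMeasure (P.map X) := Measure.isProbabilityMeasure_map hXm
  have hvar : Summable fun i => (c i * inner ℝ (b i) t) ^ 2 := by
    have hle : ∀ i, ‖c i * inner ℝ (b i) t‖ ≤ |c i| * ‖t‖ := fun i => by
      rw [norm_mul]
      refine mul_le_mul_of_nonneg_left ?_ (abs_nonneg _)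
      simpa [b.orthonormal.1 i] using norm_inner_le_norm (𝕜 := ℝ) (b i) t
    exact summable_pow_two (.of_nonneg_of_le (fun i => norm_nonneg _) hle (hc.mul_right _))
  have hmap : (P.map X).map (fun x => inner ℝ t x) = P.map (fun ω => inner ℝ t (X ω)) :=
    AEMeasurable.map_map_of_aemeasurable (by fun_prop) hXm
  have hm2 : AEMeasurable (fun ω => inner ℝ t (X ω)) P :=
    Measurable.comp_aemeasurable (g := fun x => inner ℝ t x) (by fun_prop) hXm
  have : IsProbabilityMeasure (P.map fun ω => inner ℝ t (X ω)) := Measure.isProbabilityMeasure_map hm2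
  rw [hmap]
  refine Measure.ext_of_charFun (funext fun r => ?_)
  have hconv : Tendsto (fun S : Finset ι => charFun (P.map
      (fun ω => ∑ i ∈ S, (c i * inner ℝ (b i) t) * g i ω)) r) atTop
      (𝓝 (charFun (P.map fun ω => inner ℝ t (X ω)) r)) := by
    simp only [charFun_apply_real]
    rw [integral_map hm2 (by fun_prop)]
    have h1 : ∀ S : Finset ι, ∫ x, Complex.exp (r * x * Complex.I)
        ∂(P.map (fun ω => ∑ i ∈ S, (c i * inner ℝ (b i) t) * g i ω)) =
        ∫ ω, Complex.exp (r * (∑ i ∈ S, (c i * inner ℝ (b i) t) * g i ω : ℝ) * Complex.I) ∂P :=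
      fun S => integral_map (Measurable.aemeasurable (by fun_prop)) (by fun_prop)
    simp only [h1]
    refine tendsto_integral_filter_of_dominated_convergence (fun _ => 1)
      (.of_forall fun S => (Measurable.aestronglyMeasurable (by fun_prop)))
      (.of_forall fun S => .of_forall fun ω => ?_) (integrable_const _) ?_
    · rw [← Complex.ofReal_mul, Complex.norm_exp_ofReal_mul_I]
    · filter_upwards [hX] with ω hω
      have h2 := hω.mapL (innerSL ℝ t)
      have h3 : Tendsto (fun S : Finset ι => ∑ i ∈ S, (c i * inner ℝ (b i) t) * g i ω) atTop
          (𝓝 (inner ℝ t (X ω))) := by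
        refine h2.congr fun S => Finset.sum_congr rfl fun i _ => ?_
        change inner ℝ t ((c i * g i ω) • b i) = _
        rw [inner_smul_right, real_inner_comm]
        ring
      have h4 : Continuous fun x : ℝ => Complex.exp (r * x * Complex.I) := by fun_prop
      exact (h4.tendsto _).comp h3
  refine tendsto_nhds_unique hconv ?_
  simp only [hlaw, charFun_gaussianReal]
  have h4 : Continuous fun v : ℝ => Complex.exp (r * (0 : ℝ) * Complex.I -
    (v.toNNReal : ℝ) * r ^ 2 / 2) := by fun_prop
  exact (h4.tendsto _).comp hvar.hasSum

/-- Since `∑ |c i|` is finite and the first absolute moments are bounded, the sum of the norms has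
finite expectation; the series converges absolutely almost surely. -/
lemma ae_hasSum_smul_basis [Countable ι] {Ω : Type*} [MeasurableSpace Ω] {P : Measure Ω} [CompleteSpace H]
    (b : HilbertBasis ι ℝ H) {c : ι → ℝ} (hc : Summable fun i => |c i|) {g : ι → Ω → ℝ}
    (hg : ∀ i, Measurable (g i)) {K : ℝ≥0∞} (hK : K ≠ ∞) (hgK : ∀ i, ∫⁻ ω, ‖g i ω‖ₑ ∂P ≤ K) :
    ∀ᵐ ω ∂P, HasSum (fun i => (c i * g i ω) • b i) (∑' i, (c i * g i ω) • b i) := by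
  have hsum : ∀ᵐ ω ∂P, Summable fun i => ‖c i * g i ω‖ := by
    refine ae_summable_of_summable_lintegral (fun i => ((hg i).const_mul (c i)).aemeasurable) ?_
    have h1 : ∀ i, ∫⁻ ω, ‖c i * g i ω‖ₑ ∂P ≤ ENNReal.ofReal |c i| * K := fun i => by
      simp only [enorm_mul]
      rw [lintegral_const_mul _ (hg i).enorm, Real.enorm_eq_ofReal_abs]
      exact mul_le_mul_right (hgK i) _
    refine ne_top_of_le_ne_top ?_ (ENNReal.tsum_le_tsum h1)
    rw [ENNReal.tsum_mul_right, ← ENNReal.ofReal_tsum_of_nonneg (fun i => abs_nonneg _) hc]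
    exact ENNReal.mul_ne_top ENNReal.ofReal_ne_top hK
  filter_upwards [hsum] with ω hω
  refine (Summable.of_norm ?_).hasSum
  simpa [norm_smul, b.orthonormal.1] using hω

/-- Existence of a centered Gaussian law which is diagonal in a Hilbert basis. -/
lemma exists_gaussian [Countable ι] [MeasurableSpace H] [BorelSpace H] [CompleteSpace H]
    [SecondCountableTopology H] (b : HilbertBasis ι ℝ H)
    (c : ι → ℝ) (hc : Summable fun i => |c i|) :
    ∃ μ : Measure H, IsProbabilityMeasure μ ∧ ∀ t : H, μ.map (fun x => inner ℝ t x) =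
      gaussianReal 0 (∑' i, (c i * inner ℝ (b i) t) ^ 2).toNNReal := by
  let P := Measure.infinitePi fun _ : ι => gaussianReal 0 1
  let g : ι → (ι → ℝ) → ℝ := fun i ω => ω i
  have hg : ∀ i, Measurable (g i) := fun i => measurable_pi_apply i
  have hK : ∫⁻ x, ‖x‖ₑ ∂(gaussianReal 0 1) ≠ ∞ :=
    (memLp_one_iff_integrable.1 (memLp_id_gaussianReal (μ := 0) (v := 1) 1)).2.ne
  have hgK : ∀ i, ∫⁻ ω, ‖g i ω‖ₑ ∂P ≤ ∫⁻ x, ‖x‖ₑ ∂(gaussianReal 0 1) := fun i =>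
    ((measurePreserving_eval_infinitePi (fun _ : ι => gaussianReal 0 1) i).lintegral_comp
      (f := fun x => ‖x‖ₑ) measurable_enorm).le
  have hX := ae_hasSum_smul_basis b hc hg hK hgK
  have hXm : AEMeasurable (fun ω => ∑' i, (c i * g i ω) • b i) P :=
    aemeasurable_of_tendsto_metrizable_ae (atTop : Filter (Finset ι))
      (fun S => (Finset.measurable_sum S fun i _ =>
        ((hg i).const_mul (c i)).smul_const (b i)).aemeasurable) hX
  exact ⟨P.map _, Measure.isProbabilityMeasure_map hXm, fun t =>
    map_inner_gaussian_series b hc hg (fun a S => map_sum_gaussian a S) hXm hX t⟩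

lemma isGaussian_of_map_inner [MeasurableSpace H] [BorelSpace H]
    [CompleteSpace H] {μ : Measure H} (v : H → NNReal)
    (h : ∀ t : H, μ.map (fun x => inner ℝ t x) = gaussianReal 0 (v t)) : IsGaussian μ := by
  refine isGaussian_of_map_eq_gaussianReal fun L => ⟨0, v ((InnerProductSpace.toDual ℝ H).symm L), ?_⟩
  rw [← h]
  congr 1
  ext x
  simp

lemma charFun_eq_of_map_inner [MeasurableSpace H] [OpensMeasurableSpace H] {μ : Measure H}
    {t : H} {v : NNReal}
    (h : μ.map (fun x => inner ℝ t x) = gaussianReal 0 v) :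
    charFun μ t = Complex.exp (-(v : ℂ) / 2) := by
  have h1 : charFun (μ.map (fun x => inner ℝ t x)) 1 = charFun μ t := by
    rw [charFun_apply, charFun_apply, integral_map (by fun_prop) (by fun_prop)]
    simp [real_inner_comm]
  rw [← h1, h, charFun_gaussianReal]
  simp [neg_div]

lemma lintegral_enorm_le_of_integral_sq_le {Ω : Type*} [MeasurableSpace Ω] {P : Measure Ω}
    [IsProbabilityMeasure P] {Y : Ω → ℝ} (hY : MemLp Y 2 P) {D : ℝ} (hD : 0 ≤ D)
    (h : ∫ ω, Y ω ^ 2 ∂P ≤ D ^ 2) : ∫⁻ ω, ‖Y ω‖ₑ ∂P ≤ ENNReal.ofReal D := by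
  rw [← eLpNorm_one_eq_lintegral_enorm]
  refine (eLpNorm_le_eLpNorm_of_exponent_le (by norm_num : (1 : ℝ≥0∞) ≤ 2) hY.1).trans ?_
  rw [hY.eLpNorm_eq_integral_rpow_norm (by norm_num) (by norm_num)]
  refine ENNReal.ofReal_le_ofReal ?_
  have e : ∀ ω, ‖Y ω‖ ^ (2 : ℝ≥0∞).toReal = Y ω ^ 2 := fun ω => by simp
  simp only [e]
  rw [ENNReal.toReal_ofNat, ← one_div, ← Real.sqrt_eq_rpow]
  exact Real.sqrt_le_iff.2 ⟨hD, h⟩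

/-- The orthogonal projection onto the span of finitely many vectors of a Hilbert basis. -/
def finProj (b : HilbertBasis ι ℝ H) (S : Finset ι) (x : H) : H := ∑ i ∈ S, inner ℝ (b i) x • b i

lemma continuous_finProj (b : HilbertBasis ι ℝ H) (S : Finset ι) : Continuous (finProj b S) := by
  unfold finProj
  fun_prop

/-- The triangle inequality for the tail of the basis expansion. The bound may be infinite for a
given `x`; only its expectation matters later. -/
lemma enorm_sub_finProj_le (b : HilbertBasis ι ℝ H) (S : Finset ι) (x : H) :
    ‖x - finProj b S x‖ₑ ≤ ∑' i : {i // i ∉ S}, ‖inner ℝ (b i) x‖ₑ := by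
  have h := b.hasSum_repr x
  simp only [b.repr_apply_apply] at h
  have h1 : HasSum (fun i : {i // i ∉ S} => inner ℝ (b i) x • b i) (x - finProj b S x) := by
    have h2 := S.hasSum_compl_iff (f := fun i => inner ℝ (b i) x • b i)
      (a := x - finProj b S x)
    exact h2.2 (by rw [finProj, sub_add_cancel]; exact h)
  rw [← h1.tsum_eq]
  refine enorm_tsum_le_tsum_enorm.trans (ENNReal.tsum_le_tsum fun i => ?_)
  rw [enorm_smul, ← ofReal_norm (b i), b.orthonormal.1]
  simp

/-- The truncation error depends on `μ` only through the moment bounds `D`, hence is uniform over a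
sequence of laws sharing them. -/
lemma integral_sub_finProj_le [Countable ι] [MeasurableSpace H] [BorelSpace H]
    [SecondCountableTopology H] (b : HilbertBasis ι ℝ H) {μ : Measure H}
    [IsProbabilityMeasure μ] {D : ι → ℝ} (hD : ∀ i, 0 ≤ D i) (hDs : Summable D)
    (hμ : ∀ i, ∫⁻ x, ‖inner ℝ (b i) x‖ₑ ∂μ ≤ ENNReal.ofReal (D i)) {F : H → ℝ} {K : NNReal}
    (hF : LipschitzWith K F) {C : ℝ} (hC : ∀ x y, dist (F x) (F y) ≤ C) (S : Finset ι) :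
    dist (∫ x, F x ∂μ) (∫ x, F (finProj b S x) ∂μ) ≤ K * ∑' i : {i // i ∉ S}, D i := by
  have hb : ∀ x, ‖F x‖ ≤ ‖F 0‖ + C := fun x => by
    have := hC x 0
    rw [dist_eq_norm] at this
    linarith [norm_le_norm_add_norm_sub' (F x) (F 0)]
  have hi1 : Integrable F μ := Integrable.of_bound (hF.continuous.aestronglyMeasurable) _
    (.of_forall hb)
  have hi2 : Integrable (fun x => F (finProj b S x)) μ := Integrable.of_bound
    ((hF.continuous.comp (continuous_finProj b S)).aestronglyMeasurable) _ (.of_forall fun x => hb _)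
  rw [dist_eq_norm, ← integral_sub hi1 hi2]
  have hnn : 0 ≤ ∑' i : {i // i ∉ S}, D i := tsum_nonneg fun i => hD i
  rw [← ENNReal.ofReal_le_ofReal_iff (by positivity), ofReal_norm]
  calc ‖∫ x, (F x - F (finProj b S x)) ∂μ‖ₑ
      ≤ ∫⁻ x, ‖F x - F (finProj b S x)‖ₑ ∂μ := enorm_integral_le_lintegral_enorm _
    _ ≤ ∫⁻ x, K * ∑' i : {i // i ∉ S}, ‖inner ℝ (b i) x‖ₑ ∂μ := by
        refine lintegral_mono fun x => ?_
        have := hF.edist_le_mul x (finProj b S x)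
        rw [edist_eq_enorm_sub, edist_eq_enorm_sub] at this
        exact this.trans (by gcongr; exact enorm_sub_finProj_le b S x)
    _ = K * ∑' i : {i // i ∉ S}, ∫⁻ x, ‖inner ℝ (b i) x‖ₑ ∂μ := by
        rw [lintegral_const_mul' _ _ ENNReal.coe_ne_top, lintegral_tsum fun i => by fun_prop]
    _ ≤ K * ∑' i : {i // i ∉ S}, ENNReal.ofReal (D i) := by
        gcongr with i
        exact hμ i
    _ = ENNReal.ofReal (K * ∑' i : {i // i ∉ S}, D i) := by
        rw [ENNReal.ofReal_mul K.coe_nonneg, ENNReal.ofReal_coe_nnreal,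
          ENNReal.ofReal_tsum_of_nonneg (fun i : {i // i ∉ S} => hD i)
            (hDs.comp_injective Subtype.val_injective)]

/-- The projection factors through a Euclidean space, where Lévy's continuity theorem applies. -/
lemma tendsto_map_finProj [MeasurableSpace H] [BorelSpace H] (b : HilbertBasis ι ℝ H) {ν : ℕ → ProbabilityMeasure H}
    {μ : ProbabilityMeasure H}
    (h : ∀ (S : Finset ι) (t : ι → ℝ), Tendsto (fun n => charFun (ν n : Measure H)
      (∑ i ∈ S, t i • b i)) atTop (𝓝 (charFun (μ : Measure H) (∑ i ∈ S, t i • b i))))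
    {F : H → ℝ} (hF : Continuous F) {C : ℝ} (hC : ∀ x y, dist (F x) (F y) ≤ C) (S : Finset ι) :
    Tendsto (fun n => ∫ x, F (finProj b S x) ∂(ν n : Measure H)) atTop
      (𝓝 (∫ x, F (finProj b S x) ∂(μ : Measure H))) := by
  classical
  set p : H → EuclideanSpace ℝ S := fun x => WithLp.toLp 2 fun i : S => inner ℝ (b i) x with hp
  have hpc : Continuous p := by rw [hp]; fun_prop
  set q : EuclideanSpace ℝ S → H := fun y => ∑ i : S, y i • b i with hq
  have hqc : Continuous q := by rw [hq]; fun_prop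
  have hqp : ∀ x, q (p x) = finProj b S x := fun x => by
    simp only [hq, hp, finProj]
    exact Finset.sum_coe_sort S fun i => inner ℝ (b i) x • b i
  have hch : ∀ (m : Measure H) (t : EuclideanSpace ℝ S), charFun (m.map p) t =
      charFun m (∑ i ∈ S, (if hi : i ∈ S then t ⟨i, hi⟩ else 0) • b i) := by
    intro m t
    rw [charFun_apply, charFun_apply, integral_map (hpc.aemeasurable) (by fun_prop)]
    congr 1
    ext x
    congr 3
    rw [inner_sum, ← Finset.sum_coe_sort S]
    simp [hp, PiLp.inner_apply, inner_smul_right, real_inner_comm]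
  have hlim : Tendsto (fun n => (ν n).map hpc.aemeasurable) atTop (𝓝 (μ.map hpc.aemeasurable)) := by
    refine ProbabilityMeasure.tendsto_of_tendsto_charFun fun t => ?_
    simp only [ProbabilityMeasure.toMeasure_map, hch]
    exact h S _
  have hlim2 := (ProbabilityMeasure.tendsto_iff_forall_integral_tendsto.1 hlim)
    (BoundedContinuousFunction.mkOfBound ⟨fun y => F (q y), hF.comp hqc⟩ C fun x y => hC _ _)
  have hm : ∀ m : Measure H, ∫ y, F (q y) ∂(m.map p) = ∫ x, F (finProj b S x) ∂m := fun m => by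
    rw [integral_map (f := fun y => F (q y)) hpc.aemeasurable (hF.comp hqc).aestronglyMeasurable]
    simp only [hqp]
  simpa [hm] using hlim2

/-- Convergence in law in a Hilbert space from convergence of the finite-dimensional marginals and
a uniform summable bound on the coordinates. -/
lemma tendsto_of_charFun_of_summable [Countable ι] [MeasurableSpace H] [BorelSpace H]
    [SecondCountableTopology H] (b : HilbertBasis ι ℝ H)
    {ν : ℕ → ProbabilityMeasure H} {μ : ProbabilityMeasure H} {D : ι → ℝ} (hD : ∀ i, 0 ≤ D i)
    (hDs : Summable D)
    (hν : ∀ n i, ∫⁻ x, ‖inner ℝ (b i) x‖ₑ ∂(ν n : Measure H) ≤ ENNReal.ofReal (D i))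
    (hμ : ∀ i, ∫⁻ x, ‖inner ℝ (b i) x‖ₑ ∂(μ : Measure H) ≤ ENNReal.ofReal (D i))
    (h : ∀ (S : Finset ι) (t : ι → ℝ), Tendsto (fun n => charFun (ν n : Measure H)
      (∑ i ∈ S, t i • b i)) atTop (𝓝 (charFun (μ : Measure H) (∑ i ∈ S, t i • b i)))) :
    Tendsto ν atTop (𝓝 μ) := by
  refine tendsto_iff_forall_lipschitz_integral_tendsto.2 fun F ⟨C, hC⟩ ⟨K, hK⟩ => ?_
  refine Metric.tendsto_atTop.2 fun ε hε => ?_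
  -- `S` is fixed first, making both truncation errors small for all `n` at once; then `N` is chosen
  -- for this `S`.
  have htail := (tendsto_tsum_compl_atTop_zero D).const_mul (K : ℝ)
  rw [mul_zero] at htail
  obtain ⟨S, hS⟩ := ((tendsto_order.1 htail).2 (ε / 3) (by positivity)).exists
  obtain ⟨N, hN⟩ := Metric.tendsto_atTop.1 (tendsto_map_finProj b h hK.continuous hC S) (ε / 3)
    (by positivity)
  refine ⟨N, fun n hn => ?_⟩
  have h1 := integral_sub_finProj_le b hD hDs (hν n) hK hC S
  have h2 := integral_sub_finProj_le b hD hDs hμ hK hC S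
  have h3 := hN n hn
  have h4 := dist_triangle4 (∫ x, F x ∂(ν n : Measure H)) (∫ x, F (finProj b S x) ∂(ν n : Measure H))
    (∫ x, F (finProj b S x) ∂(μ : Measure H)) (∫ x, F x ∂(μ : Measure H))
  rw [dist_comm (∫ x, F (finProj b S x) ∂(μ : Measure H))] at h4
  linarith

end GaussianHilbert

/-! ### Norms of frequencies and lattice sums. -/

section Frequencies

variable {d : ℕ}

lemma freqNorm_pos (ξ : Freq d) : 0 < freqNorm ξ := zero_lt_one.trans_le (one_le_freqNorm ξ)

lemma freqNorm_opp (ξ : Freq d) : freqNorm ξ.opp = freqNorm ξ := by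
  simp [freqNorm, Freq.opp]

lemma abs_le_freqNorm (ξ : Freq d) (i : Fin d) : |(ξ.1 i : ℝ)| ≤ freqNorm ξ := by
  refine Real.abs_le_sqrt ?_
  exact Finset.single_le_sum (f := fun i => (ξ.1 i : ℝ) ^ 2) (fun j _ => sq_nonneg _)
    (Finset.mem_univ i)

lemma exists_freqNorm_le (ξ : Freq d) : ∃ i, freqNorm ξ ≤ (d + 1) * |(ξ.1 i : ℝ)| := by
  obtain ⟨j, -⟩ := Function.ne_iff.1 ξ.2
  obtain ⟨i, -, hi⟩ := Finset.exists_max_image Finset.univ (fun i => |(ξ.1 i : ℝ)|)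
    ⟨j, Finset.mem_univ j⟩
  refine ⟨i, Real.sqrt_le_iff.2 ⟨by positivity, ?_⟩⟩
  calc ∑ k, (ξ.1 k : ℝ) ^ 2 ≤ ∑ _k : Fin d, |(ξ.1 i : ℝ)| ^ 2 :=
        Finset.sum_le_sum fun k hk => by
          rw [← sq_abs]
          exact pow_le_pow_left₀ (abs_nonneg _) (hi k hk) 2
    _ = d * |(ξ.1 i : ℝ)| ^ 2 := by simp
    _ ≤ ((d + 1) * |(ξ.1 i : ℝ)|) ^ 2 := by
        rw [mul_pow]
        refine mul_le_mul_of_nonneg_right ?_ (sq_nonneg _)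
        have : (0 : ℝ) ≤ d := Nat.cast_nonneg d
        nlinarith

/-- Compare with the lattice sum for `ℤ^d` in the sup norm: that norm is the smaller one, and for
negative `p` the comparison of powers reverses. -/
lemma summable_freqNorm_rpow {p : ℝ} (hp : p < -d) : Summable fun ξ : Freq d => freqNorm ξ ^ p := by
  let L : Submodule ℤ (Fin d → ℝ) := Submodule.span ℤ (Set.range (Pi.basisFun ℝ (Fin d)))
  have hrank : Module.finrank ℤ L = d := by
    rw [ZLattice.rank ℝ L]
    simp
  have hmem : ∀ ξ : Freq d, (fun i => (ξ.1 i : ℝ)) ∈ L := fun ξ => by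
    have h : (fun i => (ξ.1 i : ℝ)) = ∑ i, ξ.1 i • Pi.basisFun ℝ (Fin d) i := by
      ext j
      simp [Pi.single_apply]
    rw [h]
    exact Submodule.sum_mem _ fun i _ => Submodule.smul_mem _ _ (Submodule.subset_span ⟨i, rfl⟩)
  let e : Freq d → L := fun ξ => ⟨_, hmem ξ⟩
  have he : Function.Injective e := fun ξ η h => by
    apply Subtype.ext
    ext i
    have h1 : (ξ.1 i : ℝ) = η.1 i := congrFun (congrArg Subtype.val h) i
    exact_mod_cast h1
  refine ((ZLattice.summable_norm_rpow L p (by rwa [hrank])).comp_injective he).of_nonneg_of_le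
    (fun ξ => Real.rpow_nonneg (freqNorm_pos ξ).le _) fun ξ => ?_
  have hpos : 0 < ‖e ξ‖ := by
    rw [norm_pos_iff]
    intro h
    apply ξ.2
    ext i
    have h1 : (ξ.1 i : ℝ) = 0 := congrFun (congrArg Subtype.val h) i
    exact_mod_cast h1
  have hle : ‖e ξ‖ ≤ freqNorm ξ :=
    (pi_norm_le_iff_of_nonneg (freqNorm_pos ξ).le).2 fun i => abs_le_freqNorm ξ i
  exact Real.rpow_le_rpow_of_nonpos hpos hle (hp.le.trans (by simp))

end Frequencies

/-! ### Rapid decay of the Fourier coefficients of smooth functions. -/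

section Smooth

variable {d : ℕ}

/-- The covering map `ℝ^d → 𝕋^d`. -/
def torusMk (y : Fin d → ℝ) : Torus d := fun i => (y i : UnitAddCircle)

lemma isOpenQuotientMap_torusMk : IsOpenQuotientMap (torusMk (d := d)) :=
  IsOpenQuotientMap.piMap fun _ => QuotientAddGroup.isOpenQuotientMap_mk

lemma torusMk_add_single (y : Fin d → ℝ) (i : Fin d) (h : ℝ) :
    torusMk y + Pi.single i (h : UnitAddCircle) = torusMk (y + h • Pi.single i 1) := by
  ext j
  by_cases hj : j = i
  · subst hj; simp [torusMk]
  · simp [torusMk, hj]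

lemma IsSmooth.continuous {f : Torus d → ℝ} (hf : IsSmooth f) : Continuous f :=
  isOpenQuotientMap_torusMk.isQuotientMap.continuous_iff.2 (ContDiff.continuous hf)

/-- The partial derivative of a function on the torus. -/
def torusDeriv (i : Fin d) (f : Torus d → ℝ) (x : Torus d) : ℝ :=
  deriv (fun h : ℝ => f (x + Pi.single i (h : UnitAddCircle))) 0

lemma IsSmooth.hasDerivAt_mk {f : Torus d → ℝ} (hf : IsSmooth f) (i : Fin d) (y : Fin d → ℝ) :
    HasDerivAt (fun h : ℝ => f (torusMk y + Pi.single i (h : UnitAddCircle)))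
      (fderiv ℝ (fun y => f (torusMk y)) y (Pi.single i 1)) 0 := by
  simp only [torusMk_add_single]
  have h1 : DifferentiableAt ℝ (fun y => f (torusMk y)) y :=
    (ContDiff.differentiable hf (by simp)).differentiableAt
  exact h1.hasFDerivAt.hasLineDerivAt (Pi.single i 1)

lemma IsSmooth.torusDeriv_mk {f : Torus d → ℝ} (hf : IsSmooth f) (i : Fin d) (y : Fin d → ℝ) :
    torusDeriv i f (torusMk y) = fderiv ℝ (fun y => f (torusMk y)) y (Pi.single i 1) :=
  (hf.hasDerivAt_mk i y).deriv

lemma IsSmooth.torusDeriv {f : Torus d → ℝ} (hf : IsSmooth f) (i : Fin d) :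
    IsSmooth (torusDeriv i f) := by
  have h : (fun y => Sandpile.torusDeriv i f (torusMk y)) =
      fun y => fderiv ℝ (fun y => f (torusMk y)) y (Pi.single i 1) :=
    funext fun y => hf.torusDeriv_mk i y
  change ContDiff ℝ _ (fun y => Sandpile.torusDeriv i f (torusMk y))
  rw [h]
  exact (ContDiff.fderiv_right hf (by simp)).clm_apply contDiff_const

/-- Lift the translated point itself to `ℝ^d` and recentre, which reduces to the derivative at 0. -/
lemma IsSmooth.hasDerivAt {f : Torus d → ℝ} (hf : IsSmooth f) (i : Fin d) (x : Torus d) (h : ℝ) :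
    HasDerivAt (fun h : ℝ => f (x + Pi.single i (h : UnitAddCircle)))
      (Sandpile.torusDeriv i f (x + Pi.single i (h : UnitAddCircle))) h := by
  obtain ⟨y, hy⟩ := isOpenQuotientMap_torusMk.surjective (x + Pi.single i (h : UnitAddCircle))
  have h1 := hf.hasDerivAt_mk i y
  rw [← hf.torusDeriv_mk, hy] at h1
  have h2 : ∀ k : ℝ, x + Pi.single i (h : UnitAddCircle) + Pi.single i ((k - h : ℝ) : UnitAddCircle)
      = x + Pi.single i (k : UnitAddCircle) := fun k => by
    rw [add_assoc, ← Pi.single_add, ← AddCircle.coe_add, add_sub_cancel]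
  have h3 := HasDerivAt.comp_sub_const h h (f := fun k : ℝ =>
    f (x + Pi.single i (h : UnitAddCircle) + Pi.single i (k : UnitAddCircle)))
    (f' := Sandpile.torusDeriv i f (x + Pi.single i (h : UnitAddCircle))) (by rwa [sub_self])
  simpa only [h2] using h3

lemma exists_norm_le_of_continuous {f : Torus d → ℝ} (hf : Continuous f) :
    ∃ C, 0 ≤ C ∧ ∀ x, ‖f x‖ ≤ C := by
  obtain ⟨C, hC⟩ := isCompact_univ.exists_bound_of_continuousOn hf.continuousOn
  exact ⟨C, (norm_nonneg _).trans (hC 0 (Set.mem_univ _)), fun x => hC x (Set.mem_univ _)⟩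

lemma norm_mFourier (ξ : Fin d → ℤ) (x : Torus d) : ‖UnitAddTorus.mFourier ξ x‖ = 1 := by
  simp only [UnitAddTorus.mFourier, ContinuousMap.coe_mk, norm_prod, fourier_apply]
  exact Finset.prod_eq_one fun i _ => Circle.norm_coe _

lemma mFourier_add_arg (ξ : Fin d → ℤ) (x y : Torus d) :
    UnitAddTorus.mFourier ξ (x + y) = UnitAddTorus.mFourier ξ x * UnitAddTorus.mFourier ξ y := by
  simp [UnitAddTorus.mFourier, fourier_apply, smul_add, AddCircle.toCircle_add,
    Finset.prod_mul_distrib]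

lemma mFourier_single' (ξ : Fin d → ℤ) (i : Fin d) (h : ℝ) :
    UnitAddTorus.mFourier ξ (Pi.single i (h : UnitAddCircle)) =
      Complex.exp (2 * Real.pi * Complex.I * ξ i * h) := by
  have h1 : UnitAddTorus.mFourier ξ (Pi.single i (h : UnitAddCircle)) =
      ∏ j, fourier (ξ j) ((Pi.single i (h : UnitAddCircle) : Torus d) j) := rfl
  rw [h1, Finset.prod_eq_single i]
  · rw [Pi.single_eq_same, fourier_coe_apply]
    simp
  · intro j _ hj
    rw [Pi.single_eq_of_ne hj, fourier_eval_zero]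
  · simp

lemma norm_fourierCoeff_le {f : Torus d → ℝ} {C : ℝ} (hC : ∀ x, ‖f x‖ ≤ C) (ξ : Fin d → ℤ) :
    ‖fourierCoeff f ξ‖ ≤ C := by
  rw [fourierCoeff_eq_integral]
  refine (norm_integral_le_of_norm_le_const (C := C) (.of_forall fun x => ?_)).trans (by simp)
  rw [norm_mul, norm_mFourier, one_mul, Complex.norm_real]
  exact hC x

lemma fourierCoeff_translate (f : Torus d → ℝ) (ξ : Fin d → ℤ) (i : Fin d) (h : ℝ) :
    fourierCoeff (fun x => f (x + Pi.single i (h : UnitAddCircle))) ξ =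
      Complex.exp (2 * Real.pi * Complex.I * ξ i * h) * fourierCoeff f ξ := by
  rw [fourierCoeff_eq_integral, fourierCoeff_eq_integral, ← integral_const_mul]
  have hinv : (torusMeasure d).IsAddRightInvariant := by
    unfold torusMeasure; infer_instance
  rw [← integral_add_right_eq_self (μ := torusMeasure d)
    (fun x => Complex.exp (2 * Real.pi * Complex.I * ξ i * h) *
      (UnitAddTorus.mFourier (-ξ) x * (f x : ℂ))) (Pi.single i (h : UnitAddCircle))]
  congr 1
  ext x
  rw [mFourier_add_arg, mFourier_single']
  have : Complex.exp (2 * Real.pi * Complex.I * ξ i * h) *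
      Complex.exp (2 * Real.pi * Complex.I * ((-ξ) i : ℤ) * h) = 1 := by
    rw [← Complex.exp_add, ← Complex.exp_zero]
    congr 1
    simp
  linear_combination (-(UnitAddTorus.mFourier (-ξ) x * f (x + Pi.single i (h : UnitAddCircle)))) * this

/-- In place of integration by parts, the coefficient of the translate of `f` by `h e_i` is
differentiated at `h = 0` in two ways: under the integral, and through the phase factor produced by
the translation. -/
lemma IsSmooth.fourierCoeff_torusDeriv {f : Torus d → ℝ} (hf : IsSmooth f) (i : Fin d)
    (ξ : Fin d → ℤ) :
    fourierCoeff (Sandpile.torusDeriv i f) ξ = 2 * Real.pi * Complex.I * ξ i * fourierCoeff f ξ := by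
  obtain ⟨C, -, hC⟩ := exists_norm_le_of_continuous (hf.torusDeriv i).continuous
  have hfc := hf.continuous
  have hdc := (hf.torusDeriv i).continuous
  have hmc := (UnitAddTorus.mFourier (-ξ) : C(Torus d, ℂ)).continuous
  have hcont : ∀ {g : Torus d → ℝ}, Continuous g → ∀ h : ℝ, Continuous fun x : Torus d =>
      UnitAddTorus.mFourier (-ξ) x * ((g (x + Pi.single i (h : UnitAddCircle)) : ℝ) : ℂ) :=
    fun hg h => hmc.mul (Complex.continuous_ofReal.comp (hg.comp (continuous_id.add continuous_const)))
  have h1 : HasDerivAt (fun h : ℝ => ∫ x : Torus d, UnitAddTorus.mFourier (-ξ) x *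
      ((f (x + Pi.single i (h : UnitAddCircle)) : ℝ) : ℂ) ∂torusMeasure d)
      (∫ x : Torus d, UnitAddTorus.mFourier (-ξ) x * ((Sandpile.torusDeriv i f
        (x + Pi.single i ((0 : ℝ) : UnitAddCircle)) : ℝ) : ℂ) ∂torusMeasure d) 0 := by
    have hb : ∀ x : Torus d, ∀ h ∈ (Set.univ : Set ℝ), ‖UnitAddTorus.mFourier (-ξ) x *
        ((Sandpile.torusDeriv i f (x + Pi.single i (h : UnitAddCircle)) : ℝ) : ℂ)‖ ≤ C := by
      intro x h _
      rw [norm_mul, norm_mFourier, one_mul, Complex.norm_real]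
      exact hC _
    have hd : ∀ x : Torus d, ∀ h ∈ (Set.univ : Set ℝ), HasDerivAt
        (fun h : ℝ => UnitAddTorus.mFourier (-ξ) x *
          ((f (x + Pi.single i (h : UnitAddCircle)) : ℝ) : ℂ))
        (UnitAddTorus.mFourier (-ξ) x *
          ((Sandpile.torusDeriv i f (x + Pi.single i (h : UnitAddCircle)) : ℝ) : ℂ)) h := by
      intro x h _
      exact ((hf.hasDerivAt i x h).ofReal_comp).const_mul _
    have hm : ∀ h : ℝ, AEStronglyMeasurable (fun x : Torus d => UnitAddTorus.mFourier (-ξ) x *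
        ((f (x + Pi.single i (h : UnitAddCircle)) : ℝ) : ℂ)) (torusMeasure d) :=
      fun h => (hcont hfc h).aestronglyMeasurable
    have hi : Integrable (fun x : Torus d => UnitAddTorus.mFourier (-ξ) x *
        ((f (x + Pi.single i ((0 : ℝ) : UnitAddCircle)) : ℝ) : ℂ)) (torusMeasure d) := by
      obtain ⟨C', -, hC'⟩ := exists_norm_le_of_continuous hfc
      refine Integrable.of_bound (hm 0) C' (.of_forall fun x => ?_)
      rw [norm_mul, norm_mFourier, one_mul, Complex.norm_real]
      exact hC' _
    exact (hasDerivAt_integral_of_dominated_loc_of_deriv_le (μ := torusMeasure d)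
      (bound := fun _ => C) univ_mem (.of_forall hm) hi (hcont hdc 0).aestronglyMeasurable
      (.of_forall hb) (integrable_const _) (.of_forall hd)).2
  have h2 : (fun h : ℝ => ∫ x : Torus d, UnitAddTorus.mFourier (-ξ) x *
      ((f (x + Pi.single i (h : UnitAddCircle)) : ℝ) : ℂ) ∂torusMeasure d) =
      fun h : ℝ => Complex.exp (2 * Real.pi * Complex.I * ξ i * h) * fourierCoeff f ξ :=
    funext fun h => fourierCoeff_translate f ξ i h
  rw [h2] at h1
  have h3 : HasDerivAt (fun h : ℝ => Complex.exp (2 * Real.pi * Complex.I * ξ i * h) *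
      fourierCoeff f ξ) (2 * Real.pi * Complex.I * ξ i * fourierCoeff f ξ) 0 := by
    have h4 : HasDerivAt (fun h : ℝ => (2 * Real.pi * Complex.I * ξ i : ℂ) * (h : ℂ))
        (2 * Real.pi * Complex.I * ξ i) 0 := by
      simpa using (Complex.ofRealCLM.hasDerivAt (x := (0 : ℝ))).const_mul
        (2 * Real.pi * Complex.I * ξ i : ℂ)
    simpa using h4.cexp.mul_const (fourierCoeff f ξ)
  have h5 := h1.unique h3
  rw [← h5, fourierCoeff_eq_integral]
  simp

lemma IsSmooth.coord_decay (k : ℕ) : ∀ {f : Torus d → ℝ}, IsSmooth f → ∀ i : Fin d,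
    ∃ C, 0 ≤ C ∧ ∀ ξ : Fin d → ℤ, |(ξ i : ℝ)| ^ k * ‖fourierCoeff f ξ‖ ≤ C := by
  induction k with
  | zero =>
    intro f hf i
    obtain ⟨C, hC0, hC⟩ := exists_norm_le_of_continuous hf.continuous
    exact ⟨C, hC0, fun ξ => by simpa using norm_fourierCoeff_le hC ξ⟩
  | succ k ih =>
    intro f hf i
    obtain ⟨C, hC0, hC⟩ := ih (hf.torusDeriv i) i
    refine ⟨C, hC0, fun ξ => le_trans ?_ (hC ξ)⟩
    rw [hf.fourierCoeff_torusDeriv, norm_mul, pow_succ, mul_assoc]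
    refine mul_le_mul_of_nonneg_left ?_ (by positivity)
    refine mul_le_mul_of_nonneg_right ?_ (norm_nonneg _)
    have h1 : ‖(2 * Real.pi * Complex.I * ξ i : ℂ)‖ = 2 * Real.pi * |(ξ i : ℝ)| := by
      simp [abs_of_pos Real.pi_pos]
    rw [h1]
    refine le_mul_of_one_le_left (abs_nonneg _) ?_
    linarith [Real.pi_gt_three]

lemma IsSmooth.decay {f : Torus d → ℝ} (hf : IsSmooth f) (k : ℕ) :
    ∃ C, 0 ≤ C ∧ ∀ ξ : Freq d, freqNorm ξ ^ k * ‖fourierCoeff f ξ.1‖ ≤ C := by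
  choose C hC0 hC using fun i => IsSmooth.coord_decay k hf i
  refine ⟨(d + 1) ^ k * ∑ i, C i,
    mul_nonneg (by positivity) (Finset.sum_nonneg fun i _ => hC0 i), fun ξ => ?_⟩
  obtain ⟨i, hi⟩ := exists_freqNorm_le ξ
  calc freqNorm ξ ^ k * ‖fourierCoeff f ξ.1‖
      ≤ ((d + 1) * |(ξ.1 i : ℝ)|) ^ k * ‖fourierCoeff f ξ.1‖ := by
        gcongr
        exact (freqNorm_pos ξ).le
    _ = (d + 1) ^ k * (|(ξ.1 i : ℝ)| ^ k * ‖fourierCoeff f ξ.1‖) := by rw [mul_pow]; ring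
    _ ≤ (d + 1) ^ k * ∑ i, C i := by
        gcongr
        exact (hC i ξ.1).trans (Finset.single_le_sum (fun j _ => hC0 j) (Finset.mem_univ i))

lemma IsSmooth.summable {f : Torus d → ℝ} (hf : IsSmooth f) (p : ℝ) :
    Summable fun ξ : Freq d => freqNorm ξ ^ p * ‖fourierCoeff f ξ.1‖ := by
  -- Decay of order `k` leaves the exponent `p - k < -d`, which is summable.
  obtain ⟨k, hk⟩ := exists_nat_gt (p + d)
  obtain ⟨C, hC0, hC⟩ := hf.decay k
  refine ((summable_freqNorm_rpow (d := d) (p := p - k) (by linarith)).mul_left C).of_nonneg_of_le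
    (fun ξ => mul_nonneg (Real.rpow_nonneg (freqNorm_pos ξ).le _) (norm_nonneg _)) fun ξ => ?_
  rw [Real.rpow_sub (freqNorm_pos ξ), Real.rpow_natCast, mul_div_assoc', le_div_iff₀
    (pow_pos (freqNorm_pos ξ) k)]
  have := mul_le_mul_of_nonneg_left (hC ξ) (Real.rpow_nonneg (freqNorm_pos ξ).le p)
  linarith

lemma IsSmooth.summable_sq {f : Torus d → ℝ} (hf : IsSmooth f) (p : ℝ) :
    Summable fun ξ : Freq d => freqNorm ξ ^ p * ‖fourierCoeff f ξ.1‖ ^ 2 := by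
  have h := summable_pow_two (f := fun ξ : Freq d => freqNorm ξ ^ (p / 2) * ‖fourierCoeff f ξ.1‖)
    ((hf.summable (p / 2)).norm)
  refine h.congr fun ξ => ?_
  rw [mul_pow, ← Real.rpow_natCast, ← Real.rpow_mul (freqNorm_pos ξ).le]
  norm_num

end Smooth

/-! ### Parseval's identity and the variance of the limiting field. -/

section Parseval

variable {d : ℕ}

lemma inner_mFourierLp (G : C(Torus d, ℂ)) (η : Fin d → ℤ) :
    inner ℂ (UnitAddTorus.mFourierLp 2 η) (ContinuousMap.toLp 2 (torusMeasure d) ℂ G) =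
      UnitAddTorus.mFourierCoeff G η := by
  rw [← UnitAddTorus.mFourierCoeff_toLp, ← UnitAddTorus.mFourierBasis_repr,
    HilbertBasis.repr_apply_apply, UnitAddTorus.coe_mFourierBasis]
  rfl

lemma mFourierCoeff_mFourier (ξ η : Fin d → ℤ) :
    UnitAddTorus.mFourierCoeff (UnitAddTorus.mFourier ξ) η = if η = ξ then 1 else 0 := by
  rw [← inner_mFourierLp]
  exact orthonormal_iff_ite.1 UnitAddTorus.orthonormal_mFourier η ξ

lemma hasSum_norm_sq_mFourierCoeff (G : C(Torus d, ℂ)) :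
    HasSum (fun η => ‖UnitAddTorus.mFourierCoeff G η‖ ^ 2) (∫ x, ‖G x‖ ^ 2 ∂torusMeasure d) := by
  have h := UnitAddTorus.hasSum_sq_mFourierCoeff (ContinuousMap.toLp 2 (torusMeasure d) ℂ G)
  have h1 : ∫ x, ‖(ContinuousMap.toLp 2 (torusMeasure d) ℂ G : Torus d → ℂ) x‖ ^ 2
      ∂torusMeasure d = ∫ x, ‖G x‖ ^ 2 ∂torusMeasure d := by
    refine integral_congr_ae ?_
    filter_upwards [ContinuousMap.coeFn_toLp (p := 2) (𝕜 := ℂ) (torusMeasure d) G] with x hx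
    rw [hx]
  rw [← h1]
  refine h.congr_fun fun η => ?_
  exact congrArg (fun z : ℂ => ‖z‖ ^ 2) (UnitAddTorus.mFourierCoeff_toLp G η).symm

/-- Absolute summability makes the series converge uniformly to a continuous `G`. Taking a
coefficient is a continuous functional, so those of `G` are the `c ν`, with 0 at the zero frequency,
and Parseval applies. -/
lemma integral_norm_sq_tsum {c : Freq d → ℂ} (hc : Summable fun ν => ‖c ν‖) :
    ∫ x, ‖∑' ν : Freq d, c ν * UnitAddTorus.mFourier ν.1 x‖ ^ 2 ∂torusMeasure d =
      ∑' ν, ‖c ν‖ ^ 2 := by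
  have hs : Summable fun ν : Freq d => c ν • (UnitAddTorus.mFourier ν.1 : C(Torus d, ℂ)) := by
    refine Summable.of_norm ?_
    simpa [norm_smul, UnitAddTorus.mFourier_norm] using hc
  obtain ⟨G, hG⟩ := hs
  have hGx : ∀ x, ∑' ν : Freq d, c ν * UnitAddTorus.mFourier ν.1 x = G x := fun x =>
    (((ContinuousMap.evalCLM ℂ x).hasSum hG)).tsum_eq
  have hco : ∀ η, HasSum (fun ν : Freq d => c ν * if η = ν.1 then 1 else 0)
      (UnitAddTorus.mFourierCoeff G η) := fun η => by
    obtain ⟨Λ, hΛ⟩ : ∃ Λ : C(Torus d, ℂ) →L[ℂ] ℂ, ∀ G, Λ G = UnitAddTorus.mFourierCoeff G η :=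
      ⟨(innerSL ℂ (UnitAddTorus.mFourierLp 2 η)).comp
        (ContinuousMap.toLp 2 (torusMeasure d) ℂ), fun G => inner_mFourierLp G η⟩
    have h1 := Λ.hasSum hG
    rw [hΛ] at h1
    refine h1.congr_fun fun ν => ?_
    rw [map_smul, hΛ, mFourierCoeff_mFourier, smul_eq_mul]
  have hco1 : ∀ ν : Freq d, UnitAddTorus.mFourierCoeff G ν.1 = c ν := fun ν => by
    refine (hco ν.1).unique ?_
    have := hasSum_single (f := fun μ : Freq d => c μ * if ν.1 = μ.1 then 1 else 0) ν
      fun μ hμ => by rw [if_neg fun h => hμ (Subtype.ext h.symm), mul_zero]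
    simpa using this
  have hco0 : UnitAddTorus.mFourierCoeff G 0 = 0 := by
    refine (hco 0).unique ?_
    have : (fun ν : Freq d => c ν * if (0 : Fin d → ℤ) = ν.1 then 1 else 0) = fun _ => 0 := by
      ext ν
      rw [if_neg ν.2.symm, mul_zero]
    rw [this]
    exact hasSum_zero
  simp only [hGx]
  rw [← (hasSum_norm_sq_mFourierCoeff G).tsum_eq]
  simp only [← hco1]
  refine (tsum_subtype_eq_of_support_subset (s := {ξ : Fin d → ℤ | ξ ≠ 0})
    (f := fun η => ‖UnitAddTorus.mFourierCoeff G η‖ ^ 2) fun η hη => ?_).symm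
  rintro rfl
  simp [hco0] at hη

lemma IsSmooth.integral_fracLaplacian {f : Torus d → ℝ} (hf : IsSmooth f) (a : ℝ) :
    ∫ x, ‖fracLaplacian a f x‖ ^ 2 ∂torusMeasure d =
      ∑' ξ : Freq d, freqNorm ξ ^ (4 * a) * ‖fourierCoeff f ξ.1‖ ^ 2 := by
  have hnorm : ∀ ξ : Freq d, ‖((freqNorm ξ ^ (2 * a) : ℝ) : ℂ) * fourierCoeff f ξ.1‖ =
      freqNorm ξ ^ (2 * a) * ‖fourierCoeff f ξ.1‖ := fun ξ => by
    rw [norm_mul, Complex.norm_real, Real.norm_of_nonneg (Real.rpow_nonneg (freqNorm_pos ξ).le _)]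
  simp only [fracLaplacian]
  rw [integral_norm_sq_tsum (by simpa only [hnorm] using hf.summable (2 * a))]
  refine tsum_congr fun ξ => ?_
  rw [hnorm, mul_pow, ← Real.rpow_natCast, ← Real.rpow_mul (freqNorm_pos ξ).le,
    show 2 * a * ((2 : ℕ) : ℝ) = 4 * a by push_cast; ring]

end Parseval

/-! ### The real Hartley basis of the Sobolev space. -/

section Hartley

variable {d : ℕ} {s a : ℝ}

lemma Freq.opp_opp (ξ : Freq d) : ξ.opp.opp = ξ := Subtype.ext (neg_neg ξ.1)

lemma Freq.opp_ne (ξ : Freq d) : ξ.opp ≠ ξ := fun h => by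
  apply ξ.2
  have h1 : -ξ.1 = ξ.1 := congrArg Subtype.val h
  ext i
  have := congrFun h1 i
  simp only [Pi.neg_apply, Pi.zero_apply] at this ⊢
  omega

/-- The involution `ξ ↦ -ξ`. -/
def Freq.oppEquiv (d : ℕ) : Freq d ≃ Freq d := ⟨Freq.opp, Freq.opp, Freq.opp_opp, Freq.opp_opp⟩

/-- The normalized coordinate `v_ξ` of an element of the Sobolev space. -/
def SobolevSpace.coord (g : SobolevSpace d s a) (ξ : Freq d) : ℂ := (g.1 : Freq d → ℂ) ξ

lemma SobolevSpace.coord_opp (g : SobolevSpace d s a) (ξ : Freq d) :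
    g.coord ξ.opp = conj (g.coord ξ) := g.2 ξ

lemma SobolevSpace.ext_coord {g h : SobolevSpace d s a} (H : ∀ ξ, g.coord ξ = h.coord ξ) : g = h :=
  Subtype.ext (lp.ext (funext H))

lemma SobolevSpace.coord_eq (g : SobolevSpace d s a) (ξ : Freq d) :
    g.coord ξ = Real.sqrt (weight s a ξ) * g.coeff ξ := by
  have h : (Real.sqrt (weight s a ξ) : ℂ) ≠ 0 :=
    Complex.ofReal_ne_zero.2 (Real.sqrt_ne_zero'.2 (weight_pos s a ξ))
  rw [coeff, coord, Complex.ofReal_inv, mul_inv_cancel_left₀ h]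

lemma SobolevSpace.coord_add (g h : SobolevSpace d s a) (ξ : Freq d) :
    (g + h).coord ξ = g.coord ξ + h.coord ξ := rfl

lemma SobolevSpace.coord_smul (c : ℝ) (g : SobolevSpace d s a) (ξ : Freq d) :
    (c • g).coord ξ = c * g.coord ξ := rfl

lemma SobolevSpace.hasSum_inner (g h : SobolevSpace d s a) :
    HasSum (fun ξ => (h.coord ξ * conj (g.coord ξ)).re) (inner ℝ g h) :=
  lp.hasSum_inner (𝕜 := ℝ) g.1 h.1

lemma conj_one_add_I_div_two : conj ((1 + Complex.I) / 2) = (1 - Complex.I) / 2 := by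
  rw [map_div₀, map_add, map_one, Complex.conj_I, map_ofNat, sub_eq_add_neg]

lemma conj_one_sub_I_div_two : conj ((1 - Complex.I) / 2) = (1 + Complex.I) / 2 := by
  rw [map_div₀, map_sub, map_one, Complex.conj_I, map_ofNat, sub_neg_eq_add]

/-- The real (Hartley) basis vector of the Sobolev space at the frequency `ξ`. -/
def hartley (s a : ℝ) (ξ : Freq d) : SobolevSpace d s a :=
  ⟨lp.single 2 ξ ((1 + Complex.I) / 2) + lp.single 2 ξ.opp ((1 - Complex.I) / 2), fun η => by
    have h1 : η.opp = ξ ↔ η = ξ.opp := (Freq.oppEquiv d).eq_symm_apply.symm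
    have h2 : η.opp = ξ.opp ↔ η = ξ := (Freq.oppEquiv d).apply_eq_iff_eq
    simp only [lp.coeFn_add, Pi.add_apply, lp.single_apply, Pi.single_apply, h1, h2, map_add,
      apply_ite conj, map_zero, conj_one_add_I_div_two, conj_one_sub_I_div_two]
    rw [add_comm]⟩

lemma coord_hartley (ξ η : Freq d) : (hartley s a ξ).coord η =
    (if η = ξ then (1 + Complex.I) / 2 else 0) + if η = ξ.opp then (1 - Complex.I) / 2 else 0 := by
  simp [SobolevSpace.coord, hartley, lp.single_apply, Pi.single_apply]

/-- By Hermitian symmetry the entries at `ξ` and `-ξ` contribute equally, each half of the result.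
-/
lemma inner_hartley (ξ : Freq d) (g : SobolevSpace d s a) :
    inner ℝ (hartley s a ξ) g = (g.coord ξ).re + (g.coord ξ).im := by
  have h : inner ℝ (hartley s a ξ) g = inner ℝ ((1 + Complex.I) / 2) (g.coord ξ) +
      inner ℝ ((1 - Complex.I) / 2) (g.coord ξ.opp) := by
    have h1 : inner ℝ (hartley s a ξ) g = inner ℝ (lp.single 2 ξ ((1 + Complex.I) / 2) +
      lp.single 2 ξ.opp ((1 - Complex.I) / 2) : lp (fun _ : Freq d => ℂ) 2) g.1 := rfl
    rw [h1, inner_add_left, lp.inner_single_left, lp.inner_single_left]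
    rfl
  rw [h, g.coord_opp, Complex.inner, Complex.inner, conj_one_add_I_div_two, conj_one_sub_I_div_two]
  simp
  ring

lemma orthonormal_hartley : Orthonormal ℝ (hartley (d := d) s a) := by
  rw [orthonormal_iff_ite]
  intro ξ η
  rw [inner_hartley, coord_hartley]
  by_cases h1 : ξ = η
  · subst h1
    simp [(Freq.opp_ne ξ).symm]
    norm_num
  · by_cases h2 : ξ = η.opp
    · simp [h2, Freq.opp_ne]
      norm_num
    · simp [h1, h2]

/-- The coordinates at `ξ` and `-ξ` are `Re + Im` and `Re - Im` of the same complex number; if both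
vanish, so does the number. -/
lemma span_hartley_orthogonal :
    (Submodule.span ℝ (Set.range (hartley (d := d) s a)))ᗮ = ⊥ := by
  rw [Submodule.eq_bot_iff]
  intro g hg
  have h : ∀ ξ, (g.coord ξ).re + (g.coord ξ).im = 0 := fun ξ => by
    rw [← inner_hartley]
    exact (Submodule.mem_orthogonal _ _).1 hg _ (Submodule.subset_span ⟨ξ, rfl⟩)
  refine SobolevSpace.ext_coord fun ξ => ?_
  have h1 := h ξ
  have h2 := h ξ.opp
  rw [g.coord_opp, Complex.conj_re, Complex.conj_im] at h2
  change g.coord ξ = 0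
  apply Complex.ext
  · rw [Complex.zero_re]; linarith
  · rw [Complex.zero_im]; linarith

/-- The Hartley basis of the Sobolev space. -/
def hartleyBasis (d : ℕ) (s a : ℝ) : HilbertBasis (Freq d) ℝ (SobolevSpace d s a) :=
  HilbertBasis.mkOfOrthogonalEqBot orthonormal_hartley span_hartley_orthogonal

lemma hartleyBasis_apply (ξ : Freq d) : hartleyBasis d s a ξ = hartley s a ξ := by
  rw [hartleyBasis, HilbertBasis.coe_mkOfOrthogonalEqBot]

lemma inner_hartleyBasis (ξ : Freq d) (g : SobolevSpace d s a) :
    inner ℝ (hartleyBasis d s a ξ) g = (g.coord ξ).re + (g.coord ξ).im := by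
  rw [hartleyBasis_apply, inner_hartley]

instance : SecondCountableTopology (SobolevSpace d s a) := by
  have h1 := (Set.countable_range (hartleyBasis d s a)).isSeparable.span (R := ℝ)
  have h2 := h1.closure
  have h3 : closure (Submodule.span ℝ (Set.range (hartleyBasis d s a)) :
      Set (SobolevSpace d s a)) = Set.univ := by
    rw [← Submodule.topologicalClosure_coe, HilbertBasis.dense_span]
    rfl
  rw [h3] at h2
  have := TopologicalSpace.isSeparable_univ_iff.1 h2
  exact UniformSpace.secondCountable_of_separable _

end Hartley

/-! ### Pairing with a test function as an inner product. -/

section Pairing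

variable {d : ℕ} {s a : ℝ}

/-- Dividing by the weight costs only a power of `‖ξ‖`, which the rapid decay of the coefficients
absorbs. -/
lemma summable_weight_div {f : Torus d → ℝ} (hf : IsSmooth f) :
    Summable fun ξ : Freq d =>
      weight s a ξ * ‖((weight s a ξ)⁻¹ : ℝ) * fourierCoeff f ξ.1‖ ^ 2 := by
  refine (hf.summable_sq (4 * s - 4 * a)).congr fun ξ => ?_
  have hw := weight_pos s a ξ
  rw [norm_mul, Complex.norm_real, Real.norm_of_nonneg (inv_nonneg.2 hw.le), mul_pow]
  have h1 : weight s a ξ * ((weight s a ξ)⁻¹) ^ 2 = freqNorm ξ ^ (4 * s - 4 * a) := by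
    have h2 : weight s a ξ * ((weight s a ξ)⁻¹) ^ 2 = (weight s a ξ)⁻¹ := by
      field_simp
    rw [h2, weight, multiplier, ← Real.rpow_add (freqNorm_pos ξ), ← Real.rpow_neg (freqNorm_pos ξ).le]
    congr 1
    ring
  rw [← mul_assoc, h1]

/-- The vector representing the pairing with a smooth test function. -/
def testVector (s a : ℝ) {f : Torus d → ℝ} (hf : IsSmooth f) : SobolevSpace d s a :=
  SobolevSpace.ofCoeff (fun ξ => ((weight s a ξ)⁻¹ : ℝ) * fourierCoeff f ξ.1)
    (fun ξ => by
      have h : fourierCoeff f ξ.opp.1 = conj (fourierCoeff f ξ.1) := fourierCoeff_neg f ξ.1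
      rw [weight_opp, h, map_mul, Complex.conj_ofReal])
    (summable_weight_div hf)

lemma coord_testVector {f : Torus d → ℝ} (hf : IsSmooth f) (ξ : Freq d) :
    (testVector s a hf).coord ξ = ((Real.sqrt (weight s a ξ))⁻¹ : ℝ) * fourierCoeff f ξ.1 := by
  rw [SobolevSpace.coord_eq, testVector, SobolevSpace.coeff_ofCoeff, ← mul_assoc,
    ← Complex.ofReal_mul]
  congr 2
  rw [← Real.sqrt_div_self, div_eq_mul_inv]

lemma pairing_eq_inner {f : Torus d → ℝ} (hf : IsSmooth f) (g : SobolevSpace d s a) :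
    SobolevSpace.pairing f g = inner ℝ (testVector s a hf) g := by
  rw [← (SobolevSpace.hasSum_inner _ _).tsum_eq, SobolevSpace.pairing]
  refine tsum_congr fun ξ => ?_
  rw [coord_testVector, SobolevSpace.coeff, map_mul, Complex.conj_ofReal]
  congr 1
  rw [SobolevSpace.coord]
  ring

/-- Averaging over `ξ ↦ -ξ` removes the cross term: `(x+y)² + (x-y)² = 2(x²+y²)`. This passes from
Hartley coordinates back to Fourier coefficients. -/
lemma tsum_mul_sq_re_add_im {r : Freq d → ℝ} (hr : ∀ ξ, r ξ.opp = r ξ) {v : Freq d → ℂ}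
    (hv : ∀ ξ, v ξ.opp = conj (v ξ)) (hs : Summable fun ξ => r ξ * ‖v ξ‖ ^ 2)
    (hr0 : ∀ ξ, 0 ≤ r ξ) :
    ∑' ξ, r ξ * ((v ξ).re + (v ξ).im) ^ 2 = ∑' ξ, r ξ * ‖v ξ‖ ^ 2 := by
  have hsq : ∀ ξ, ‖v ξ‖ ^ 2 = (v ξ).re ^ 2 + (v ξ).im ^ 2 := fun ξ => by
    rw [← Complex.normSq_eq_norm_sq, Complex.normSq_apply]; ring
  have h1 : Summable fun ξ => r ξ * ((v ξ).re + (v ξ).im) ^ 2 := by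
    refine (hs.mul_left 2).of_nonneg_of_le (fun ξ => mul_nonneg (hr0 ξ) (sq_nonneg _)) fun ξ => ?_
    rw [hsq, mul_left_comm]
    refine mul_le_mul_of_nonneg_left ?_ (hr0 ξ)
    nlinarith [sq_nonneg ((v ξ).re - (v ξ).im)]
  have h2 := (Freq.oppEquiv d).tsum_eq fun ξ => r ξ * ((v ξ).re + (v ξ).im) ^ 2
  have h3 := (Freq.oppEquiv d).summable_iff.2 h1
  have h4 : ∀ ξ, r (Freq.oppEquiv d ξ) * ((v (Freq.oppEquiv d ξ)).re +
      (v (Freq.oppEquiv d ξ)).im) ^ 2 = r ξ * ((v ξ).re - (v ξ).im) ^ 2 := fun ξ => by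
    change r ξ.opp * ((v ξ.opp).re + (v ξ.opp).im) ^ 2 = _
    rw [hr, hv, Complex.conj_re, Complex.conj_im, sub_eq_add_neg]
  simp only [Function.comp_def, h4] at h2 h3
  have h5 := h1.tsum_add h3
  rw [h2] at h5
  have h6 : ∀ ξ, r ξ * ((v ξ).re + (v ξ).im) ^ 2 + r ξ * ((v ξ).re - (v ξ).im) ^ 2 =
      2 * (r ξ * ‖v ξ‖ ^ 2) := fun ξ => by
    rw [hsq]; ring
  simp only [h6, tsum_mul_left] at h5
  linarith

end Pairing

/-! ### Trigonometric polynomials realizing the finite combinations of basis vectors. -/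

section TrigPolynomials

variable {d : ℕ} {s a : ℝ}

/-- The function `cos (2πξ·x) - sin (2πξ·x)`. -/
def cosSubSin (ξ : Freq d) (x : Torus d) : ℝ :=
  (UnitAddTorus.mFourier ξ.1 x).re - (UnitAddTorus.mFourier ξ.1 x).im

lemma mFourier_torusMk (ξ : Fin d → ℤ) (y : Fin d → ℝ) :
    UnitAddTorus.mFourier ξ (torusMk y) = Complex.exp ((2 * Real.pi * ∑ i, ξ i * y i : ℝ) * Complex.I) := by
  have h : UnitAddTorus.mFourier ξ (torusMk y) = ∏ i, fourier (ξ i) (y i : UnitAddCircle) := rfl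
  simp only [h, fourier_coe_apply, ← Complex.exp_sum]
  congr 1
  push_cast
  rw [Finset.mul_sum, Finset.sum_mul]
  exact Finset.sum_congr rfl fun i _ => by ring

lemma isSmooth_cosSubSin (ξ : Freq d) : IsSmooth (cosSubSin ξ) := by
  change ContDiff ℝ _ (fun y => cosSubSin ξ (torusMk y))
  have h : ∀ y : Fin d → ℝ, cosSubSin ξ (torusMk y) =
      Real.cos (2 * Real.pi * ∑ i, ξ.1 i * y i) - Real.sin (2 * Real.pi * ∑ i, ξ.1 i * y i) := by
    intro y
    rw [cosSubSin, mFourier_torusMk, Complex.exp_ofReal_mul_I_re, Complex.exp_ofReal_mul_I_im]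
  simp only [h]
  fun_prop

lemma integrable_mFourier_mul (η : Fin d → ℤ) {f : Torus d → ℝ} (hf : Continuous f) :
    Integrable (fun x => UnitAddTorus.mFourier η x * (f x : ℂ)) (torusMeasure d) := by
  obtain ⟨C, -, hC⟩ := exists_norm_le_of_continuous hf
  refine Integrable.of_bound (Continuous.aestronglyMeasurable ?_) C (.of_forall fun x => ?_)
  · exact (UnitAddTorus.mFourier η : C(Torus d, ℂ)).continuous.mul (Complex.continuous_ofReal.comp hf)
  · rw [norm_mul, norm_mFourier, one_mul, Complex.norm_real]
    exact hC x

lemma fourierCoeff_sum {κ : Type*} (S : Finset κ) (c : κ → ℝ) {f : κ → Torus d → ℝ}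
    (hf : ∀ k, Continuous (f k)) (η : Fin d → ℤ) :
    fourierCoeff (fun x => ∑ k ∈ S, c k * f k x) η = ∑ k ∈ S, c k * fourierCoeff (f k) η := by
  simp only [fourierCoeff_eq_integral, ← integral_const_mul]
  rw [← integral_finsetSum _ fun k _ => (integrable_mFourier_mul (-η) (hf k)).const_mul _]
  congr 1
  ext x
  push_cast
  rw [Finset.mul_sum]
  exact Finset.sum_congr rfl fun k _ => by ring

lemma fourierCoeff_cosSubSin (ξ : Freq d) (η : Fin d → ℤ) :
    fourierCoeff (cosSubSin ξ) η = (if η = ξ.1 then (1 + Complex.I) / 2 else 0) +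
      if η = ξ.opp.1 then (1 - Complex.I) / 2 else 0 := by
  have h : ∀ x, ((cosSubSin ξ x : ℝ) : ℂ) = (1 + Complex.I) / 2 * UnitAddTorus.mFourier ξ.1 x +
      (1 - Complex.I) / 2 * UnitAddTorus.mFourier (-ξ.1) x := fun x => by
    rw [UnitAddTorus.mFourier_neg, cosSubSin]
    apply Complex.ext <;> simp <;> ring
  have hi : ∀ ζ : Fin d → ℤ, Integrable (fun x => UnitAddTorus.mFourier (-η) x *
      UnitAddTorus.mFourier ζ x) (torusMeasure d) := fun ζ => by
    refine Integrable.of_bound (Continuous.aestronglyMeasurable ?_) 1 (.of_forall fun x => ?_)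
    · exact (UnitAddTorus.mFourier (-η) * UnitAddTorus.mFourier ζ : C(Torus d, ℂ)).continuous
    · rw [norm_mul, norm_mFourier, norm_mFourier, one_mul]
  have hc : ∀ ζ : Fin d → ℤ, ∫ x, UnitAddTorus.mFourier (-η) x * UnitAddTorus.mFourier ζ x
      ∂torusMeasure d = if η = ζ then 1 else 0 := fun ζ => mFourierCoeff_mFourier ζ η
  rw [fourierCoeff_eq_integral]
  simp only [h, mul_add, mul_left_comm (UnitAddTorus.mFourier (-η) _ : ℂ)]
  rw [integral_add ((hi _).const_mul _) ((hi _).const_mul _), integral_const_mul,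
    integral_const_mul, hc, hc]
  congr 1
  · simp
  · by_cases h2 : η = ξ.opp.1
    · rw [if_pos h2, if_pos (show η = -ξ.1 from h2), mul_one]
    · rw [if_neg h2, if_neg (show η ≠ -ξ.1 from h2), mul_zero]

/-- The trigonometric polynomial whose test vector is `∑ t_ξ b_ξ`. -/
def trigPoly (s a : ℝ) (S : Finset (Freq d)) (t : Freq d → ℝ) (x : Torus d) : ℝ :=
  ∑ ξ ∈ S, (t ξ * Real.sqrt (weight s a ξ)) * cosSubSin ξ x

lemma isSmooth_trigPoly (S : Finset (Freq d)) (t : Freq d → ℝ) : IsSmooth (trigPoly s a S t) := by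
  change ContDiff ℝ _ (fun y => ∑ ξ ∈ S, _ * cosSubSin ξ (torusMk y))
  exact ContDiff.sum fun ξ _ => contDiff_const.mul (isSmooth_cosSubSin ξ)

lemma fourierCoeff_trigPoly (S : Finset (Freq d)) (t : Freq d → ℝ) (η : Fin d → ℤ) :
    fourierCoeff (trigPoly s a S t) η = ∑ ξ ∈ S, ((t ξ * Real.sqrt (weight s a ξ) : ℝ) : ℂ) *
      ((if η = ξ.1 then (1 + Complex.I) / 2 else 0) +
      if η = ξ.opp.1 then (1 - Complex.I) / 2 else 0) := by
  simp only [← fourierCoeff_cosSubSin]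
  exact fourierCoeff_sum S _ (fun ξ => (isSmooth_cosSubSin ξ).continuous) η

lemma integral_trigPoly (S : Finset (Freq d)) (t : Freq d → ℝ) :
    ∫ x, trigPoly s a S t x ∂torusMeasure d = 0 := by
  have h := fourierCoeff_trigPoly (s := s) (a := a) S t 0
  have h1 : ∀ ξ : Freq d, (0 : Fin d → ℤ) ≠ ξ.1 := fun ξ => ξ.2.symm
  simp only [h1, if_false, add_zero, mul_zero, Finset.sum_const_zero] at h
  rw [fourierCoeff_eq_integral] at h
  simp only [neg_zero, UnitAddTorus.mFourier_zero, ContinuousMap.one_apply, one_mul] at h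
  rw [integral_complex_ofReal] at h
  exact_mod_cast h

lemma coord_sum_hartley (S : Finset (Freq d)) (t : Freq d → ℝ) (η : Freq d) :
    (∑ ξ ∈ S, t ξ • hartley s a ξ).coord η = ∑ ξ ∈ S, (t ξ : ℂ) * (hartley s a ξ).coord η := by
  classical
  induction S using Finset.induction_on with
  | empty => rfl
  | insert ξ S hξ ih =>
    rw [Finset.sum_insert hξ, Finset.sum_insert hξ, SobolevSpace.coord_add,
      SobolevSpace.coord_smul, ih]

lemma testVector_trigPoly (S : Finset (Freq d)) (t : Freq d → ℝ) :
    testVector s a (isSmooth_trigPoly (s := s) (a := a) S t) = ∑ ξ ∈ S, t ξ • hartleyBasis d s a ξ := by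
  refine SobolevSpace.ext_coord fun η => ?_
  simp only [hartleyBasis_apply]
  rw [coord_testVector, fourierCoeff_trigPoly, coord_sum_hartley, Finset.mul_sum]
  refine Finset.sum_congr rfl fun ξ _ => ?_
  have h0 : Real.sqrt (weight s a η) ≠ 0 := Real.sqrt_ne_zero'.2 (weight_pos s a η)
  rw [coord_hartley]
  simp only [Subtype.ext_iff.symm]
  -- The square root of the weight at `ξ` must cancel the one at `η`. Only `η = ±ξ` contributes, and
  -- the weight is even.
  by_cases h1 : η = ξ ∨ η = ξ.opp
  · have hw : weight s a ξ = weight s a η := by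
      rcases h1 with rfl | rfl
      · rfl
      · rw [weight_opp]
    rw [hw, ← mul_assoc, ← Complex.ofReal_mul]
    congr 2
    field_simp
  · push Not at h1
    simp [h1.1, h1.2]

end TrigPolynomials

/-! ### Discrete Hartley functions: orthonormality and diagonalization of the covariance. -/

section HartleyTransform

variable {d n : ℕ} [NeZero n]

/-- The real function `cos (2πz·w/n) - sin (2πz·w/n)` on the discrete torus. -/
def discHartley (w z : DTorus d n) : ℝ := (discChar w z).re - (discChar w z).im

lemma discHartley_eq (w z : DTorus d n) : (discHartley w z : ℂ) =
    (1 + Complex.I) / 2 * discChar w z + (1 - Complex.I) / 2 * discChar (-w) z := by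
  rw [← conj_discChar, discHartley]
  apply Complex.ext <;> simp <;> ring

lemma discInner_discHartley (w ν : DTorus d n) :
    discInner (fun z => (discHartley w z : ℂ)) (discChar ν) =
      (1 + Complex.I) / 2 * (if w = ν then 1 else 0) +
        (1 - Complex.I) / 2 * (if -w = ν then 1 else 0) := by
  simp only [discHartley_eq]
  rw [discInner_add_left, discInner_const_mul_left, discInner_const_mul_left, discInner_discChar,
    discInner_discChar]

lemma conj_discInner (f g : DTorus d n → ℂ) : conj (discInner f g) = discInner g f := by
  simp only [discInner, map_mul, map_sum, map_inv₀, map_pow, Complex.conj_natCast, Complex.conj_conj]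
  congr 1
  exact Finset.sum_congr rfl fun z _ => mul_comm _ _

lemma discInner_discHartley_self (w v : DTorus d n) :
    discInner (fun z => (discHartley w z : ℂ)) (fun z => (discHartley v z : ℂ)) =
      if w = v then 1 else 0 := by
  have h : ∀ ν : DTorus d n, discInner (discChar ν) (fun z => (discHartley v z : ℂ)) =
      (1 - Complex.I) / 2 * (if v = ν then 1 else 0) +
        (1 + Complex.I) / 2 * (if -v = ν then 1 else 0) := fun ν => by
    rw [← conj_discInner, discInner_discHartley, map_add, map_mul, map_mul,
      conj_one_add_I_div_two, conj_one_sub_I_div_two]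
    simp only [apply_ite conj, map_one, map_zero]
  simp only [discHartley_eq w]
  rw [discInner_add_left, discInner_const_mul_left, discInner_const_mul_left, h, h]
  have e1 : v = -w ↔ -v = w := by rw [eq_neg_iff_add_eq_zero, neg_eq_iff_add_eq_zero]
  simp only [e1, neg_inj, eq_comm (a := w)]
  have hI : Complex.I ^ 2 = -1 := Complex.I_sq
  split_ifs
  · ring
  · linear_combination (-1 / 2 : ℂ) * hI
  · linear_combination (1 / 2 : ℂ) * hI
  · ring

/-- A Hartley function combines `ψ_w` and `ψ_{-w}`, whose eigenvalues agree. -/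
lemma discFracLaplacian_discHartley (t : ℝ) {w : DTorus d n} (hw : w ≠ 0) (x : DTorus d n) :
    discFracLaplacian t (fun z => (discHartley w z : ℂ)) x =
      (((-eigenvalue w) ^ (-t) : ℝ) : ℂ) * discHartley w x := by
  simp only [discFracLaplacian, discInner_discHartley]
  have h : ∀ ν : DTorus d n, (((-eigenvalue ν) ^ (-t) : ℝ) : ℂ) *
      ((1 + Complex.I) / 2 * (if w = ν then 1 else 0) +
        (1 - Complex.I) / 2 * (if -w = ν then 1 else 0)) * discChar ν x =
      (if w = ν then (((-eigenvalue ν) ^ (-t) : ℝ) : ℂ) * ((1 + Complex.I) / 2 * discChar ν x) else 0) +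
      if -w = ν then (((-eigenvalue ν) ^ (-t) : ℝ) : ℂ) * ((1 - Complex.I) / 2 * discChar ν x) else 0 := by
    intro ν
    split_ifs <;> ring
  simp only [h, Finset.sum_add_distrib, Finset.sum_ite_eq, Finset.mem_filter, Finset.mem_univ,
    true_and, hw, ne_eq, not_false_eq_true, if_true, eigenvalue_neg, neg_eq_zero]
  rw [discHartley_eq]
  ring

/-- The Hartley transform on the discrete torus. -/
def hartleyTransform (w : DTorus d n) : (DTorus d n → ℝ) →L[ℝ] ℝ :=
  ∑ z, (((n : ℝ) ^ d)⁻¹ * discHartley w z) • ContinuousLinearMap.proj (R := ℝ) z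

lemma hartleyTransform_apply (w : DTorus d n) (f : DTorus d n → ℝ) :
    hartleyTransform w f = ∑ z, ((n : ℝ) ^ d)⁻¹ * discHartley w z * f z := by
  simp [hartleyTransform]

lemma hartleyTransform_eq (w : DTorus d n) (f : DTorus d n → ℝ) :
    hartleyTransform w f = (discInner (fun z => (f z : ℂ)) (discChar w)).re +
      (discInner (fun z => (f z : ℂ)) (discChar w)).im := by
  have h : ((n : ℂ) ^ d)⁻¹ = ((((n : ℝ) ^ d)⁻¹ : ℝ) : ℂ) := by push_cast; rfl
  rw [discInner, h, Complex.re_ofReal_mul, Complex.im_ofReal_mul, Complex.re_sum, Complex.im_sum,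
    ← mul_add, ← Finset.sum_add_distrib, hartleyTransform_apply, Finset.mul_sum]
  refine Finset.sum_congr rfl fun z _ => ?_
  rw [Complex.re_ofReal_mul, Complex.im_ofReal_mul, Complex.conj_re, Complex.conj_im, discHartley]
  ring

lemma discInner_ofReal_discHartley (w : DTorus d n) (f : DTorus d n → ℝ) :
    discInner (fun z => (f z : ℂ)) (fun z => (discHartley w z : ℂ)) = (hartleyTransform w f : ℝ) := by
  rw [hartleyTransform_apply, discInner, Finset.mul_sum]
  push_cast
  refine Finset.sum_congr rfl fun z _ => ?_
  rw [Complex.conj_ofReal]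
  ring

end HartleyTransform

/-! ### Mean and covariance of the initial Gaussian field in Hartley coordinates. -/

section DiscreteField

variable {d n : ℕ} [NeZero n] {Ω : Type*} [MeasurableSpace Ω] {P : Measure Ω}
  {σ : Ω → DTorus d n → ℝ}

lemma integral_clm_eq_zero {A : (DTorus d n → ℂ) → DTorus d n → ℂ} (hσ : IsCenteredGaussian P σ A)
    (Λ : (DTorus d n → ℝ) →L[ℝ] ℝ) : ∫ ω, Λ (σ ω) ∂P = 0 := by
  have hi := hσ.gaussian.integrable
  rw [Λ.integral_comp_comm hi]
  have : ∫ ω, σ ω ∂P = 0 := by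
    ext x
    rw [eval_integral fun i => (Integrable.eval hi i)]
    exact hσ.centered x
  rw [this, map_zero]

lemma integral_hartleyTransform_mul {s : ℝ} (hσ : IsCenteredGaussian P σ
      (fun f x => ((scaling d n ^ (2 * s) : ℝ) : ℂ) * discFracLaplacian (2 * s) f x))
    {w : DTorus d n} (hw : w ≠ 0) (v : DTorus d n) :
    ∫ ω, hartleyTransform w (σ ω) * hartleyTransform v (σ ω) ∂P =
      if w = v then scaling d n ^ (2 * s) * (-eigenvalue w) ^ (-(2 * s)) else 0 := by
  have h := hσ.covariance (discHartley w) (discHartley v)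
  simp only [discInner_ofReal_discHartley, discFracLaplacian_discHartley _ hw] at h
  rw [discInner_const_mul_left, discInner_const_mul_left, discInner_discHartley_self] at h
  simp only [← Complex.ofReal_mul] at h
  rw [integral_complex_ofReal] at h
  apply Complex.ofReal_injective
  rw [h]
  split_ifs <;> simp

end DiscreteField

/-! ### The rescaled odometer as a Gaussian element of the Sobolev space. -/

section Field

variable {d n : ℕ} [NeZero n] {s a : ℝ}

/-- The interpolated rescaled odometer as an element of the Sobolev space. -/
def odometerField (s a : ℝ) (σ : DTorus d n → ℝ) : SobolevSpace d s a :=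
  SobolevSpace.ofFun (fun x => scaling d n * interpolation (odometer (initialConfig σ)) x)

/-- The Fourier multiplier taking the initial field to the rescaled odometer. -/
def fieldCoeff (s a : ℝ) (n : ℕ) (ξ : Freq d) : ℝ :=
  Real.sqrt (weight s a ξ) *
    (sincProd n ξ.1 * (scaling d n * (-eigenvalue (freqMod n ξ.1))⁻¹))

lemma inner_odometerField (hd : d ≠ 0) (ha : a ≤ s) (σ : DTorus d n → ℝ) (ξ : Freq d) :
    inner ℝ (hartleyBasis d s a ξ) (odometerField s a σ) =
      fieldCoeff s a n ξ * hartleyTransform (freqMod n ξ.1) σ := by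
  have h : (odometerField s a σ).coord ξ = (fieldCoeff s a n ξ : ℝ) *
      discInner (fun x => (σ x : ℂ)) (discChar (freqMod n ξ.1)) := by
    rw [SobolevSpace.coord_eq, odometerField, SobolevSpace.coeff_ofFun ha (memLp_interpolation _ _),
      fourierCoeff_interpolation, fieldCoeff]
    -- At frequencies congruent to 0 mod `n` both sides vanish through the sinc factor; elsewhere
    -- the Poisson equation identifies the odometer mode.
    by_cases hw : freqMod n ξ.1 = 0
    · rw [sincProd_eq_zero ξ.2 hw]
      simp
    · rw [discInner_odometer hd σ hw]
      push_cast
      ring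
  rw [inner_hartleyBasis, h, Complex.re_ofReal_mul, Complex.im_ofReal_mul, hartleyTransform_eq]
  ring

/-- The Hartley expansion exhibits the field as a pointwise limit of finite sums whose coefficients
are linear in `σ`. -/
lemma measurable_odometerField (hd : d ≠ 0) (ha : a ≤ s) :
    Measurable (odometerField s a : (DTorus d n → ℝ) → SobolevSpace d s a) := by
  refine measurable_of_tendsto_metrizable' (atTop : Filter (Finset (Freq d)))
    (f := fun S σ => ∑ ξ ∈ S, (fieldCoeff s a n ξ * hartleyTransform (freqMod n ξ.1) σ) •
      hartleyBasis d s a ξ) (fun S => ?_) ?_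
  · refine Finset.measurable_sum S fun ξ _ => Measurable.smul_const ?_ _
    exact (hartleyTransform _).continuous.measurable.const_mul _
  · refine tendsto_pi_nhds.2 fun σ => ?_
    have h := (hartleyBasis d s a).hasSum_repr (odometerField s a σ)
    simp only [HilbertBasis.repr_apply_apply, inner_odometerField hd ha] at h
    exact h

variable {Ω : Type*} [MeasurableSpace Ω] {P : Measure Ω} {σ : Ω → DTorus d n → ℝ}

lemma aemeasurable_odometerField (hd : d ≠ 0) (ha : a ≤ s)
    {A : (DTorus d n → ℂ) → DTorus d n → ℂ} (hσ : IsCenteredGaussian P σ A) :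
    AEMeasurable (fun ω => odometerField s a (σ ω)) P :=
  (measurable_odometerField hd ha).comp_aemeasurable hσ.gaussian.aemeasurable

/-- The covariance of the Hartley coordinates of the rescaled odometer. -/
def fieldCov (s a : ℝ) (n : ℕ) (ξ η : Freq d) : ℝ :=
  fieldCoeff s a n ξ * fieldCoeff s a n η *
    if freqMod n ξ.1 = freqMod n η.1 then
      scaling d n ^ (2 * s) * (-eigenvalue (freqMod n ξ.1)) ^ (-(2 * s)) else 0

lemma fieldCoeff_eq_zero {ξ : Freq d} (h : freqMod n ξ.1 = 0) : fieldCoeff s a n ξ = 0 := by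
  rw [fieldCoeff, sincProd_eq_zero ξ.2 h]
  ring

lemma integral_fieldCoeff_mul (hσ : IsCenteredGaussian P σ
      (fun f x => ((scaling d n ^ (2 * s) : ℝ) : ℂ) * discFracLaplacian (2 * s) f x))
    (ξ η : Freq d) :
    ∫ ω, (fieldCoeff s a n ξ * hartleyTransform (freqMod n ξ.1) (σ ω)) *
      (fieldCoeff s a n η * hartleyTransform (freqMod n η.1) (σ ω)) ∂P = fieldCov s a n ξ η := by
  by_cases hw : freqMod n ξ.1 = 0
  · simp [fieldCov, fieldCoeff_eq_zero hw]
  · simp only [mul_mul_mul_comm (fieldCoeff s a n ξ)]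
    rw [integral_const_mul, integral_hartleyTransform_mul hσ hw, fieldCov]

lemma memLp_clm {A : (DTorus d n → ℂ) → DTorus d n → ℂ} (hσ : IsCenteredGaussian P σ A)
    (Λ : (DTorus d n → ℝ) →L[ℝ] ℝ) : MemLp (fun ω => Λ (σ ω)) 2 P :=
  (hσ.gaussian.map_fun Λ).memLp_two

/-- Linear functionals of the rescaled odometer are centered Gaussian. -/
lemma map_inner_odometerField (hd : d ≠ 0) (ha : a ≤ s) (hσ : IsCenteredGaussian P σ
      (fun f x => ((scaling d n ^ (2 * s) : ℝ) : ℂ) * discFracLaplacian (2 * s) f x))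
    (S : Finset (Freq d)) (t : Freq d → ℝ) :
    (P.map fun ω => odometerField s a (σ ω)).map
        (fun x => inner ℝ (∑ ξ ∈ S, t ξ • hartleyBasis d s a ξ) x) =
      gaussianReal 0 (∑ ξ ∈ S, ∑ η ∈ S, t ξ * t η * fieldCov s a n ξ η).toNNReal := by
  have hprob : IsProbabilityMeasure P := hσ.gaussian.isProbabilityMeasure
  set Λ : (DTorus d n → ℝ) →L[ℝ] ℝ :=
    ∑ ξ ∈ S, (t ξ * fieldCoeff s a n ξ) • hartleyTransform (freqMod n ξ.1) with hΛ
  have hΛa : ∀ f, Λ f = ∑ ξ ∈ S, t ξ * (fieldCoeff s a n ξ * hartleyTransform (freqMod n ξ.1) f) :=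
    fun f => by simp [hΛ, mul_assoc]
  have h1 : (P.map fun ω => odometerField s a (σ ω)).map
      (fun x => inner ℝ (∑ ξ ∈ S, t ξ • hartleyBasis d s a ξ) x) = P.map (fun ω => Λ (σ ω)) := by
    rw [AEMeasurable.map_map_of_aemeasurable (by fun_prop) (aemeasurable_odometerField hd ha hσ)]
    congr 1
    ext ω
    rw [Function.comp_apply, sum_inner, hΛa]
    simp only [inner_smul_left, inner_odometerField hd ha]
    rfl
  have h2 : Var[fun ω => Λ (σ ω); P] = ∑ ξ ∈ S, ∑ η ∈ S, t ξ * t η * fieldCov s a n ξ η := by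
    rw [variance_of_integral_eq_zero (memLp_clm hσ Λ).aemeasurable (integral_clm_eq_zero hσ Λ)]
    have h3 : ∀ ω, Λ (σ ω) ^ 2 = ∑ ξ ∈ S, ∑ η ∈ S, t ξ * t η *
        ((fieldCoeff s a n ξ * hartleyTransform (freqMod n ξ.1) (σ ω)) *
          (fieldCoeff s a n η * hartleyTransform (freqMod n η.1) (σ ω))) := fun ω => by
      rw [hΛa, sq, Finset.sum_mul_sum]
      exact Finset.sum_congr rfl fun ξ _ => Finset.sum_congr rfl fun η _ => by ring
    have hi : ∀ ξ η : Freq d, Integrable (fun ω => t ξ * t η *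
        ((fieldCoeff s a n ξ * hartleyTransform (freqMod n ξ.1) (σ ω)) *
          (fieldCoeff s a n η * hartleyTransform (freqMod n η.1) (σ ω)))) P := fun ξ η =>
      (((memLp_clm hσ _).const_mul _).integrable_mul ((memLp_clm hσ _).const_mul _)).const_mul _
    simp only [h3]
    rw [integral_finsetSum _ fun ξ _ => integrable_finsetSum _ fun η _ => hi ξ η]
    refine Finset.sum_congr rfl fun ξ _ => ?_
    rw [integral_finsetSum _ fun η _ => hi ξ η]
    refine Finset.sum_congr rfl fun η _ => ?_
    rw [integral_const_mul, integral_fieldCoeff_mul hσ]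
  rw [h1, (hσ.gaussian.map_fun Λ).map_eq_gaussianReal, h2]
  congr 1
  exact integral_clm_eq_zero hσ Λ

end Field

/-! ### Limits and uniform bounds of the covariances. -/

section Asymptotics

variable {d : ℕ} {s a : ℝ}

lemma sin_sq_val_intCast {n : ℕ} [NeZero n] (k : ℤ) :
    Real.sin (Real.pi * (((k : ZMod n)).val : ℝ) / n) ^ 2 = Real.sin (Real.pi * k / n) ^ 2 := by
  have h1 := stdAddChar_add_conj (k : ZMod n)
  have h : (ZMod.stdAddChar (k : ZMod n) : ℂ) =
      Complex.exp ((2 * (Real.pi * k / n) : ℝ) * Complex.I) := by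
    rw [ZMod.stdAddChar_coe]
    congr 1
    push_cast
    ring
  rw [← conj_stdAddChar, Complex.add_conj, h, Complex.exp_ofReal_mul_I_re, Real.cos_two_mul,
    Real.cos_sq'] at h1
  have h2 := Complex.ofReal_injective h1
  linarith

lemma scaling_pos (hd : d ≠ 0) {n : ℕ} (hn : n ≠ 0) : 0 < scaling d n := by
  have : 0 < d := Nat.pos_of_ne_zero hd
  have : 0 < n := Nat.pos_of_ne_zero hn
  have := Real.pi_pos
  unfold scaling
  positivity

/-- Writing `sin x = x sinc x` factors out exactly `a_n`; the remaining sum tends to `‖ξ‖²`. -/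
lemma neg_eigenvalue_freqMod {n : ℕ} [NeZero n] (ξ : Fin d → ℤ) :
    -eigenvalue (freqMod n ξ) =
      scaling d n * ∑ i, (ξ i : ℝ) ^ 2 * Real.sinc (Real.pi * ξ i / n) ^ 2 := by
  have hn : (n : ℝ) ≠ 0 := Nat.cast_ne_zero.2 (NeZero.ne n)
  have h : ∀ k : ℤ, Real.sin (Real.pi * k / n) ^ 2 =
      Real.pi ^ 2 * ((n : ℝ) ^ 2)⁻¹ * ((k : ℝ) ^ 2 * Real.sinc (Real.pi * k / n) ^ 2) := fun k => by
    by_cases hk : k = 0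
    · subst hk; simp
    · have hk' : (k : ℝ) ≠ 0 := Int.cast_ne_zero.2 hk
      have hp := Real.pi_ne_zero
      rw [Real.sinc_of_ne_zero (by positivity)]
      field_simp
  simp only [eigenvalue, freqMod, sin_sq_val_intCast, h, ← Finset.mul_sum, scaling]
  ring

/-- The ratio `a_n / (-λ_ξ)`. -/
def eigenRatio (n : ℕ) (ξ : Freq d) : ℝ := scaling d n * (-eigenvalue (freqMod n ξ.1))⁻¹

lemma eigenRatio_nonneg (hd : d ≠ 0) {n : ℕ} [NeZero n] (ξ : Freq d) : 0 ≤ eigenRatio n ξ := by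
  rw [eigenRatio, neg_eigenvalue_freqMod]
  have := scaling_pos hd (NeZero.ne n)
  positivity

/-- The constant is `a_n` divided by the spectral gap bound `(4/2d)(2/n)²`. At frequencies congruent
to 0 the ratio is 0, since the inverse of 0 is 0. -/
lemma eigenRatio_le (hd : d ≠ 0) {n : ℕ} [NeZero n] (ξ : Freq d) :
    eigenRatio n ξ ≤ Real.pi ^ 2 / 4 := by
  have hs := scaling_pos hd (NeZero.ne n)
  by_cases hw : freqMod n ξ.1 = 0
  · have : eigenvalue (freqMod n ξ.1) = 0 := by rw [hw]; simp [eigenvalue]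
    rw [eigenRatio, this]
    simp only [neg_zero, inv_zero, mul_zero]
    positivity
  · have h1 := le_neg_eigenvalue hw
    have hd' : (d : ℝ) ≠ 0 := Nat.cast_ne_zero.2 hd
    have hn : (n : ℝ) ≠ 0 := Nat.cast_ne_zero.2 (NeZero.ne n)
    rw [eigenRatio, ← div_eq_mul_inv, div_le_iff₀ (neg_eigenvalue_pos hd hw)]
    refine le_trans (le_of_eq ?_) (mul_le_mul_of_nonneg_left h1 (by positivity))
    rw [scaling]
    field_simp
    norm_num

lemma tendsto_eigenRatio (hd : d ≠ 0) (ξ : Freq d) :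
    Tendsto (fun n : ℕ => eigenRatio n ξ) atTop (𝓝 (freqNorm ξ ^ (-2 : ℝ))) := by
  have h1 : Tendsto (fun n : ℕ => (∑ i, (ξ.1 i : ℝ) ^ 2 * Real.sinc (Real.pi * ξ.1 i / n) ^ 2)⁻¹)
      atTop (𝓝 (freqNorm ξ ^ (-2 : ℝ))) := by
    have hpos : freqNorm ξ ^ (-2 : ℝ) = (∑ i, (ξ.1 i : ℝ) ^ 2 * 1 ^ 2)⁻¹ := by
      rw [Real.rpow_neg (freqNorm_pos ξ).le, Real.rpow_two, freqNorm,
        Real.sq_sqrt (Finset.sum_nonneg fun i _ => sq_nonneg _)]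
      simp
    have hne : (∑ i, (ξ.1 i : ℝ) ^ 2 * 1 ^ 2) ≠ 0 := by
      have := (Real.rpow_pos_of_pos (freqNorm_pos ξ) (-2)).ne'
      rw [hpos] at this
      exact fun h => this (by rw [h, inv_zero])
    rw [hpos]
    refine Tendsto.inv₀ (tendsto_finsetSum _ fun i _ => (Tendsto.pow ?_ 2).const_mul _) hne
    have := (Real.continuous_sinc.tendsto 0).comp (tendsto_div_natCast (Real.pi * ξ.1 i))
    rwa [Real.sinc_zero] at this
  refine h1.congr' ?_
  filter_upwards [eventually_gt_atTop 0] with n hn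
  have : NeZero n := ⟨hn.ne'⟩
  rw [eigenRatio, neg_eigenvalue_freqMod, mul_inv, ← mul_assoc,
    mul_inv_cancel₀ (scaling_pos hd hn.ne').ne', one_mul]

lemma eventually_freqMod_ne_zero {ζ : Fin d → ℤ} (hζ : ζ ≠ 0) :
    ∀ᶠ n : ℕ in atTop, freqMod n ζ ≠ 0 := by
  obtain ⟨i, hi⟩ := Function.ne_iff.1 hζ
  have hi : ζ i ≠ 0 := hi
  filter_upwards [eventually_gt_atTop (ζ i).natAbs] with n hn h
  have h1 := (ZMod.intCast_zmod_eq_zero_iff_dvd (ζ i) n).1 (congrFun h i)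
  exact hi (Int.eq_zero_of_abs_lt_dvd h1 (by rw [Int.abs_eq_natAbs]; exact_mod_cast hn))

/-- Aliasing needs `n` to divide every coordinate of `ξ - η`, which fails once `n` exceeds the
modulus of a nonzero one. -/
lemma eventually_freqMod_ne {ξ η : Freq d} (h : ξ ≠ η) :
    ∀ᶠ n : ℕ in atTop, freqMod n ξ.1 ≠ freqMod n η.1 := by
  filter_upwards [eventually_freqMod_ne_zero (sub_ne_zero.2 (Subtype.coe_injective.ne h))] with n hn h1
  apply hn
  ext i
  have := congrFun h1 i
  simp only [freqMod] at this
  simp [freqMod, this]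

lemma fieldCov_self (hd : d ≠ 0) {n : ℕ} [NeZero n] (ξ : Freq d) :
    fieldCov s a n ξ ξ = weight s a ξ * sincProd n ξ.1 ^ 2 * eigenRatio n ξ ^ 2 *
      eigenRatio n ξ ^ (2 * s) := by
  have hs := scaling_pos hd (NeZero.ne n)
  have hl : 0 ≤ -eigenvalue (freqMod n ξ.1) := by
    rw [neg_eigenvalue_freqMod]
    positivity
  have h1 : fieldCoeff s a n ξ = Real.sqrt (weight s a ξ) * (sincProd n ξ.1 * eigenRatio n ξ) := rfl
  have h2 : scaling d n ^ (2 * s) * (-eigenvalue (freqMod n ξ.1)) ^ (-(2 * s)) =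
      eigenRatio n ξ ^ (2 * s) := by
    rw [eigenRatio, Real.mul_rpow hs.le (inv_nonneg.2 hl), Real.inv_rpow hl, Real.rpow_neg hl]
  have h3 := Real.mul_self_sqrt (weight_pos s a ξ).le
  rw [fieldCov, if_pos rfl, h2, h1]
  linear_combination (sincProd n ξ.1 ^ 2 * eigenRatio n ξ ^ 2 * eigenRatio n ξ ^ (2 * s)) * h3

/-- The standard deviation of the Hartley coordinates of the limiting field. -/
def limitStd (s a : ℝ) (ξ : Freq d) : ℝ :=
  Real.sqrt (weight s a ξ) * freqNorm ξ ^ (-2 * (s + 1))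

lemma limitStd_sq (ξ : Freq d) :
    limitStd s a ξ ^ 2 = weight s a ξ * freqNorm ξ ^ (4 * -(s + 1)) := by
  rw [limitStd, mul_pow, Real.sq_sqrt (weight_pos s a ξ).le, ← Real.rpow_natCast,
    ← Real.rpow_mul (freqNorm_pos ξ).le]
  congr 2
  push_cast
  ring

lemma tendsto_fieldCov (hd : d ≠ 0) (hs : 0 < s) (ξ η : Freq d) :
    Tendsto (fun n : ℕ => fieldCov s a n ξ η) atTop
      (𝓝 (if ξ = η then limitStd s a ξ ^ 2 else 0)) := by
  split_ifs with h
  · subst h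
    have hρ := tendsto_eigenRatio hd ξ
    have h1 := ((((tendsto_sincProd ξ.1).pow 2).const_mul (weight s a ξ)).mul (hρ.pow 2)).mul
      (hρ.rpow_const (p := 2 * s) (Or.inr (by linarith)))
    have h2 : weight s a ξ * 1 ^ 2 * (freqNorm ξ ^ (-2 : ℝ)) ^ 2 * (freqNorm ξ ^ (-2 : ℝ)) ^ (2 * s) =
        limitStd s a ξ ^ 2 := by
      have hf := freqNorm_pos ξ
      rw [limitStd_sq, ← Real.rpow_natCast (freqNorm ξ ^ (-2 : ℝ)), ← Real.rpow_mul hf.le,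
        ← Real.rpow_mul hf.le, one_pow, mul_one, mul_assoc, ← Real.rpow_add hf]
      congr 2
      push_cast
      ring
    rw [h2] at h1
    refine h1.congr' ?_
    filter_upwards [eventually_gt_atTop 0] with n hn
    have : NeZero n := ⟨hn.ne'⟩
    rw [fieldCov_self hd]
  · refine tendsto_const_nhds.congr' ?_
    filter_upwards [eventually_freqMod_ne h] with n hn
    rw [fieldCov, if_neg hn, mul_zero]

/-- A uniform bound for the standard deviation of the Hartley coordinates. -/
def stdBound (s a : ℝ) (ξ : Freq d) : ℝ :=
  Real.sqrt (weight s a ξ) * ((Real.pi ^ 2 / 4) * (Real.pi ^ 2 / 4) ^ s)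

lemma stdBound_nonneg (ξ : Freq d) : 0 ≤ stdBound s a ξ := by
  unfold stdBound
  positivity

lemma fieldCov_self_le (hd : d ≠ 0) (hs : 0 < s) {n : ℕ} [NeZero n] (ξ : Freq d) :
    fieldCov s a n ξ ξ ≤ stdBound s a ξ ^ 2 := by
  have h0 := eigenRatio_nonneg hd (n := n) ξ
  have h1 := eigenRatio_le hd (n := n) ξ
  have h2 : sincProd n ξ.1 ^ 2 ≤ 1 := by
    rw [← sq_abs]
    exact pow_le_one₀ (abs_nonneg _) (abs_sincProd_le_one n ξ.1)
  have hw := (weight_pos s a ξ).le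
  have h3 : stdBound s a ξ ^ 2 = weight s a ξ * 1 * (Real.pi ^ 2 / 4) ^ 2 *
      (Real.pi ^ 2 / 4) ^ (2 * s) := by
    rw [stdBound, mul_pow, mul_pow, Real.sq_sqrt hw, ← Real.rpow_natCast _ 2,
      ← Real.rpow_natCast ((Real.pi ^ 2 / 4) ^ s) 2, ← Real.rpow_mul (by positivity)]
    push_cast
    ring_nf
  rw [fieldCov_self hd, h3]
  gcongr

lemma limitStd_nonneg (ξ : Freq d) : 0 ≤ limitStd s a ξ :=
  mul_nonneg (Real.sqrt_nonneg _) (Real.rpow_nonneg (freqNorm_pos ξ).le _)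

lemma limitStd_le (hs : 0 < s) (ξ : Freq d) : limitStd s a ξ ≤ stdBound s a ξ := by
  refine mul_le_mul_of_nonneg_left ?_ (Real.sqrt_nonneg _)
  -- With the constant at least 1, the same bound serves the limiting field, since `‖ξ‖ ≥ 1`.
  have hp : 1 ≤ Real.pi ^ 2 / 4 := by nlinarith [Real.pi_gt_three]
  exact (Real.rpow_le_one_of_one_le_of_nonpos (one_le_freqNorm ξ) (by linarith)).trans
    (one_le_mul_of_one_le_of_one_le hp (Real.one_le_rpow hp hs.le))

lemma summable_stdBound (h : 2 * a - 2 * s < -d) : Summable (stdBound (d := d) s a) := by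
  refine ((summable_freqNorm_rpow h).mul_right
    ((Real.pi ^ 2 / 4) * (Real.pi ^ 2 / 4) ^ s)).congr fun ξ => ?_
  rw [stdBound, weight, multiplier, ← Real.rpow_add (freqNorm_pos ξ), Real.sqrt_eq_rpow,
    ← Real.rpow_mul (freqNorm_pos ξ).le]
  congr 2
  ring

lemma summable_limitStd (hs : 0 < s) (h : 2 * a - 2 * s < -d) :
    Summable fun ξ : Freq d => |limitStd s a ξ| :=
  (summable_stdBound h).of_nonneg_of_le (fun ξ => abs_nonneg _) fun ξ => by
    rw [abs_of_nonneg (limitStd_nonneg ξ)]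
    exact limitStd_le hs ξ

end Asymptotics

/-! ### Identification and uniqueness of the limiting law. -/

section Limit

variable {d : ℕ} {s a : ℝ}

/-- The weight in `limitStd` squared cancels the inverse weight of the test vector, so the variance
does not depend on the exponent `a` of the space. -/
lemma tsum_sq_limitStd_testVector {f : Torus d → ℝ} (hf : IsSmooth f) :
    ∑' ξ, (limitStd s a ξ * inner ℝ (hartleyBasis d s a ξ) (testVector s a hf)) ^ 2 =
      ∫ x, ‖fracLaplacian (-(s + 1)) f x‖ ^ 2 ∂torusMeasure d := by
  have h : ∀ ξ : Freq d,
      (limitStd s a ξ * inner ℝ (hartleyBasis d s a ξ) (testVector s a hf)) ^ 2 =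
        freqNorm ξ ^ (4 * -(s + 1)) *
          ((fourierCoeff f ξ.1).re + (fourierCoeff f ξ.1).im) ^ 2 := fun ξ => by
    have hw := weight_pos s a ξ
    rw [mul_pow, limitStd_sq, inner_hartleyBasis, coord_testVector, Complex.re_ofReal_mul,
      Complex.im_ofReal_mul, ← mul_add, mul_pow, inv_pow, Real.sq_sqrt hw.le]
    field_simp
  rw [hf.integral_fracLaplacian]
  simp only [h]
  exact tsum_mul_sq_re_add_im (fun ξ => by rw [freqNorm_opp]) (fun ξ => fourierCoeff_neg f ξ.1)
    (hf.summable_sq _) fun ξ => Real.rpow_nonneg (freqNorm_pos ξ).le _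

lemma isFractionalField_of_map_inner {μ : Measure (SobolevSpace d s a)}
    (hμ : ∀ t, μ.map (fun x => inner ℝ t x) = gaussianReal 0
      (∑' ξ, (limitStd s a ξ * inner ℝ (hartleyBasis d s a ξ) t) ^ 2).toNNReal) :
    IsFractionalField μ := fun f hf _ => by
  rw [funext (pairing_eq_inner hf), hμ, tsum_sq_limitStd_testVector]

/-- Testing against trigonometric polynomials fixes the characteristic function on finite
combinations of the basis; density and continuity fix it everywhere. -/
lemma IsFractionalField.eq {μ ν : Measure (SobolevSpace d s a)} [IsProbabilityMeasure μ]
    [IsProbabilityMeasure ν] (hμ : IsFractionalField μ) (hν : IsFractionalField ν) : ν = μ := by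
  have h : ∀ (S : Finset (Freq d)) (t : Freq d → ℝ),
      charFun ν (∑ ξ ∈ S, t ξ • hartleyBasis d s a ξ) =
        charFun μ (∑ ξ ∈ S, t ξ • hartleyBasis d s a ξ) := fun S t => by
    have h1 := hμ _ (isSmooth_trigPoly S t) (integral_trigPoly (s := s) (a := a) S t)
    have h2 := hν _ (isSmooth_trigPoly S t) (integral_trigPoly (s := s) (a := a) S t)
    rw [funext (pairing_eq_inner (isSmooth_trigPoly S t)), testVector_trigPoly] at h1 h2
    rw [charFun_eq_of_map_inner h1, charFun_eq_of_map_inner h2]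
  refine Measure.ext_of_charFun (funext fun x => ?_)
  have hx := (hartleyBasis d s a).hasSum_repr x
  refine tendsto_nhds_unique ((continuous_charFun.tendsto x).comp hx) ?_
  refine ((continuous_charFun.tendsto x).comp hx).congr fun S => ?_
  exact (h S _).symm

lemma sq_sum_smul_hartleyBasis (S : Finset (Freq d)) (t : Freq d → ℝ) :
    ∑' ξ, (limitStd s a ξ * inner ℝ (hartleyBasis d s a ξ)
        (∑ η ∈ S, t η • hartleyBasis d s a η)) ^ 2 =
      ∑ ξ ∈ S, ∑ η ∈ S, t ξ * t η * if ξ = η then limitStd s a ξ ^ 2 else 0 := by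
  classical
  have h : ∀ ξ, inner ℝ (hartleyBasis d s a ξ) (∑ η ∈ S, t η • hartleyBasis d s a η) =
      if ξ ∈ S then t ξ else 0 := fun ξ => by
    simp [inner_sum, inner_smul_right, orthonormal_iff_ite.1 (hartleyBasis d s a).orthonormal]
  simp only [h]
  rw [tsum_eq_sum (s := S) fun ξ hξ => by simp [hξ]]
  refine Finset.sum_congr rfl fun ξ hξ => ?_
  simp only [hξ, if_true, mul_ite, mul_zero, Finset.sum_ite_eq]
  ring

lemma lintegral_inner_le {μ : Measure (SobolevSpace d s a)} [IsProbabilityMeasure μ]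
    {t : SobolevSpace d s a} {v : ℝ} (h : μ.map (fun x => inner ℝ t x) = gaussianReal 0 v.toNNReal)
    {D : ℝ} (hD : 0 ≤ D) (hv : v ≤ D ^ 2) :
    ∫⁻ x, ‖(inner ℝ t x : ℝ)‖ₑ ∂μ ≤ ENNReal.ofReal D := by
  have hm : Measurable fun x : SobolevSpace d s a => (inner ℝ t x : ℝ) := by fun_prop
  rw [← lintegral_map (f := fun y : ℝ => ‖y‖ₑ) measurable_enorm hm, h]
  have h2 : MemLp id 2 (gaussianReal 0 v.toNNReal) := memLp_id_gaussianReal 2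
  refine lintegral_enorm_le_of_integral_sq_le h2 hD ?_
  rw [← variance_of_integral_eq_zero h2.aemeasurable integral_id_gaussianReal,
    variance_id_gaussianReal, Real.coe_toNNReal']
  exact max_le hv (sq_nonneg D)

end Limit

/-! ### Convergence in law of the rescaled odometers. -/

lemma tendsto_map_odometerField {d : ℕ} (hd : d ≠ 0) {s a : ℝ} (hs : 0 < s) (ha : a ≤ s)
    (had : 2 * a - 2 * s < -d) {Ω : ℕ+ → Type*} [∀ n, MeasurableSpace (Ω n)]
    {P : ∀ n, Measure (Ω n)} [∀ n, IsProbabilityMeasure (P n)] {σ : ∀ n : ℕ+, Ω n → DTorus d n → ℝ}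
    (hσ : ∀ n : ℕ+, IsCenteredGaussian (P n) (σ n)
      (fun f x => ((scaling d n ^ (2 * s) : ℝ) : ℂ) * discFracLaplacian (2 * s) f x))
    {μ : ProbabilityMeasure (SobolevSpace d s a)}
    (hμ : ∀ t, (μ : Measure (SobolevSpace d s a)).map (fun x => inner ℝ t x) = gaussianReal 0
      (∑' ξ, (limitStd s a ξ * inner ℝ (hartleyBasis d s a ξ) t) ^ 2).toNNReal) :
    Tendsto (β := ProbabilityMeasure (SobolevSpace d s a)) (fun n : ℕ+ => ⟨(P n).map fun ω => odometerField s a (σ n ω),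
      Measure.isProbabilityMeasure_map (aemeasurable_odometerField hd ha (hσ n))⟩) atTop (𝓝 μ) := by
  -- Reindex by `k ↦ k + 1` to obtain a sequence over `ℕ`.
  rw [← OrderIso.pnatIsoNat.symm.map_atTop]
  refine tendsto_map' ?_
  have hk : ∀ k : ℕ, ((OrderIso.pnatIsoNat.symm k : ℕ+) : ℕ) = k + 1 := fun k => by
    rw [OrderIso.pnatIsoNat_symm_apply, Nat.succPNat_coe]
  have hprob : ∀ n : ℕ+, IsProbabilityMeasure ((P n).map fun ω => odometerField s a (σ n ω)) :=
    fun n => Measure.isProbabilityMeasure_map (aemeasurable_odometerField hd ha (hσ n))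
  refine tendsto_of_charFun_of_summable (hartleyBasis d s a) (D := stdBound s a) stdBound_nonneg
    (summable_stdBound had) (fun k ξ => ?_) (fun ξ => ?_) fun S t => ?_
  · have h := map_inner_odometerField hd ha (hσ (OrderIso.pnatIsoNat.symm k)) {ξ} fun _ => 1
    simp only [Finset.sum_singleton, one_smul, one_mul] at h
    exact lintegral_inner_le h (stdBound_nonneg ξ) (fieldCov_self_le hd hs ξ)
  · have h1 := sq_sum_smul_hartleyBasis (s := s) (a := a) {ξ} fun _ => 1
    have h2 := hμ (hartleyBasis d s a ξ)
    simp only [Finset.sum_singleton, one_smul, one_mul, if_true] at h1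
    rw [h1] at h2
    exact lintegral_inner_le h2 (stdBound_nonneg ξ)
      (pow_le_pow_left₀ (limitStd_nonneg ξ) (limitStd_le hs ξ) 2)
  -- Both laws are centered Gaussian along the chosen direction, so convergence of the finite double
  -- sum of covariances is all that is needed.
  · have hlim := tendsto_finsetSum S fun ξ _ => tendsto_finsetSum S fun η _ =>
      (tendsto_fieldCov (s := s) (a := a) hd hs ξ η).const_mul (t ξ * t η)
    have hlim1 := hlim.comp (tendsto_add_atTop_nat 1)
    have hlim2 := ((Complex.continuous_ofReal.comp
      (NNReal.continuous_coe.comp continuous_real_toNNReal)).tendsto _).comp hlim1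
    have hlim3 := (Complex.continuous_exp.tendsto _).comp (hlim2.neg.div_const 2)
    rw [charFun_eq_of_map_inner (hμ _), sq_sum_smul_hartleyBasis]
    refine hlim3.congr fun k => ?_
    have h := charFun_eq_of_map_inner
      (map_inner_odometerField hd ha (hσ (OrderIso.pnatIsoNat.symm k)) S t)
    simp only [hk] at h
    exact h.symm

end

end Sandpile

/-! ### The scaling limit, with Sobolev exponent `a = -ε`. -/

theorem proposition4 (d : ℕ) (hd : 1 ≤ d) (s : ℝ) (hs : 0 < s)
    (ε : ℝ) (hε : max ((d : ℝ) / 2) (1 + (d : ℝ) / 4) < ε)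
    {Ω : ℕ+ → Type*} [∀ n, MeasurableSpace (Ω n)]
    (P : ∀ n, Measure (Ω n)) [∀ n, IsProbabilityMeasure (P n)]
    (σ : ∀ n : ℕ+, Ω n → Sandpile.DTorus d n → ℝ)
    (hσ : ∀ n : ℕ+, Sandpile.IsCenteredGaussian (P n) (σ n)
      (fun f x => ((Sandpile.scaling d n ^ (2 * s) : ℝ) : ℂ) *
        Sandpile.discFracLaplacian (2 * s) f x)) :
    -- the odometers are finite
    (∀ (n : ℕ+) (ω : Ω n) (x : Sandpile.DTorus d n),
      Summable (Sandpile.emission (Sandpile.initialConfig (σ n ω)) x)) ∧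
    -- the limiting field exists, its law is unique, and the convergence in law holds
    ∃ (μ : Measure (Sandpile.SobolevSpace d s (-ε))) (_ : IsProbabilityMeasure μ),
      IsGaussian μ ∧
      Sandpile.IsFractionalField μ ∧
      (∀ ν : Measure (Sandpile.SobolevSpace d s (-ε)), IsProbabilityMeasure ν →
        Sandpile.IsFractionalField ν → ν = μ) ∧
      TendstoInDistribution
        (fun (n : ℕ+) (ω : Ω n) =>
          (Sandpile.SobolevSpace.ofFun (fun x => Sandpile.scaling d n *
            Sandpile.interpolation
              (Sandpile.odometer (Sandpile.initialConfig (σ n ω))) x) :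
            Sandpile.SobolevSpace d s (-ε)))
        atTop id P μ := by
  have hd0 : d ≠ 0 := by omega
  obtain ⟨h1, h2⟩ := max_lt_iff.1 hε
  have hd1 : (1 : ℝ) ≤ d := by exact_mod_cast hd
  have ha : -ε ≤ s := by linarith
  -- This is the summability exponent of the standard deviations; it comes from `ε > d/2` and `s >
  -- 0`.
  have had : 2 * -ε - 2 * s < -d := by linarith
  refine ⟨fun n ω x => Sandpile.summable_emission hd0 _ (Sandpile.sum_initialConfig_sub_one _) x, ?_⟩
  obtain ⟨μ, hμp, hμ⟩ := Sandpile.exists_gaussian (Sandpile.hartleyBasis d s (-ε))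
    (Sandpile.limitStd s (-ε)) (Sandpile.summable_limitStd hs had)
  have hfrac := Sandpile.isFractionalField_of_map_inner hμ
  refine ⟨μ, hμp, Sandpile.isGaussian_of_map_inner _ hμ, hfrac, fun ν hν hνf => hfrac.eq hνf,
    fun n => Sandpile.aemeasurable_odometerField hd0 ha (hσ n), aemeasurable_id, ?_⟩
  have h := Sandpile.tendsto_map_odometerField hd0 hs ha had hσ (μ := ⟨μ, hμp⟩) hμ
  simp only [Measure.map_id]
  exact h
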